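/- An \emph{orthogonal terrain} $T$ is an $x$-monotone polygonal chain in the plane with vertices $v_1,\dots,v_n$ ($n\ge 1$), ordered from left to right along the chain. Each edge is horizontal or vertical, consecutive edges are perpendicular, and the leftmost and rightmost edges are horizontal rays that start at $v_1$ and $v_n$ respectively. A vertex is \emph{convex} (resp. \emph{reflex}) if the angle between its two incident edges, measured above $T$, is $\pi/2$ (resp. $3\pi/2$). A reflex vertex $g$ \emph{sees} a convex vertex $c$ if every point of the segment $gc$, except its endpoints, lies strictly above $T$. A \emph{guard set} is a set $S$ of reflex vertices such that every convex vertex is seen by some vertex of $S$. The Vertex Terrain Guarding (VTG) problem asks, given the vertex coordinates of $T$, for a guard set of minimum cardinality, or for the answer that no guard set exists. \textbf{Theorem.} There is a polynomial-time exact algorithm for the VTG problem on orthogonal terrains. More precisely, there is one random access program, with arrays of natural numbers (with addition, truncated subtraction and comparison) and arrays of coordinate numbers (with $+$, $-$, $\times$ and comparison), that halts with the correct answer on every orthogonal terrain and satisfies both of the following. (i) For real coordinates, with unit cost for each operation on real numbers and bit-length cost for natural numbers (real RAM), its running time is bounded by a polynomial in the number $n$ of vertices. (ii) For rational coordinates,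 with each operation and memory access charged by the bit length of its result, its running time is bounded by a polynomial in the total bit length of the coordinates. -/

import Mathlib

namespace VTG

/-! ### Orthogonal terrains and vertex guarding -/

/-- An orthogonal terrain with `n` vertices `v 0, …, v (n - 1)`, listed from left to right along the
chain, where `v i = (x i, y i)`. The leftmost and the rightmost edge are horizontal rays that start
at the first and at the last vertex, and horizontal and vertical edges alternate (every vertex is
a genuine corner). Hence the edge from `v i` to `v (i + 1)` is vertical for even `i` and horizontal
for odd `i`; as the edge from `v (n - 2)` to `v (n - 1)` precedes the right ray, it is vertical,
so `n` is even. -/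
structure OrthogonalTerrain (n : ℕ) where
  x : Fin n → ℝ
  y : Fin n → ℝ
  pos : 0 < n
  even : Even n
  vertical : ∀ i j : Fin n, (j : ℕ) = i + 1 → Even (i : ℕ) → x i = x j ∧ y i ≠ y j
  horizontal : ∀ i j : Fin n, (j : ℕ) = i + 1 → Odd (i : ℕ) → x i < x j ∧ y i = y j

namespace OrthogonalTerrain

variable {n : ℕ}

/-- The vertex with index `i`, as a point of the plane. -/
def pt (T : OrthogonalTerrain n) (i : Fin n) : ℝ × ℝ := (T.x i, T.y i)

/-- The index of the leftmost vertex. -/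
def first (T : OrthogonalTerrain n) : Fin n := ⟨0, T.pos⟩

/-- The index of the rightmost vertex. -/
def last (T : OrthogonalTerrain n) : Fin n := ⟨n - 1, Nat.sub_lt T.pos Nat.one_pos⟩

/-- The terrain as a set of points: the left ray, the right ray and all the edges. -/
def carrier (T : OrthogonalTerrain n) : Set (ℝ × ℝ) :=
  {p | p.1 ≤ T.x T.first ∧ p.2 = T.y T.first} ∪
  {p | T.x T.last ≤ p.1 ∧ p.2 = T.y T.last} ∪
  {p | ∃ i j : Fin n, (j : ℕ) = i + 1 ∧ p ∈ segment ℝ (T.pt i) (T.pt j)}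

/-- A point lies strictly above the terrain if it is higher than every point of the terrain
on the vertical line through it. -/
def StrictlyAbove (T : OrthogonalTerrain n) (p : ℝ × ℝ) : Prop :=
  ∀ q ∈ T.carrier, q.1 = p.1 → q.2 < p.2

/-- `i` and `j` are the two endpoints of a vertical edge. Every vertex is an endpoint of exactly one
vertical edge, its other incident edge (or ray) being horizontal. -/
def VerticalEdge (_T : OrthogonalTerrain n) (i j : Fin n) : Prop :=
  (Even (i : ℕ) ∧ (j : ℕ) = i + 1) ∨ (Even (j : ℕ) ∧ (i : ℕ) = j + 1)

/-- A vertex is convex if the angle above the terrain between its two incident edges is `π / 2`,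
that is, if its vertical edge goes up from it. -/
def IsConvex (T : OrthogonalTerrain n) (i : Fin n) : Prop :=
  ∃ j, T.VerticalEdge i j ∧ T.y i < T.y j

/-- A vertex is reflex if the angle above the terrain between its two incident edges is `3 π / 2`,
that is, if its vertical edge goes down from it. -/
def IsReflex (T : OrthogonalTerrain n) (i : Fin n) : Prop :=
  ∃ j, T.VerticalEdge i j ∧ T.y j < T.y i

/-- Strict visibility: every point of the segment between the two vertices, except for its
endpoints, lies strictly above the terrain. -/
def Sees (T : OrthogonalTerrain n) (u v : Fin n) : Prop :=
  ∀ p ∈ openSegment ℝ (T.pt u) (T.pt v), T.StrictlyAbove p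

/-- A set of reflex vertices such that every convex vertex is seen by one of them. -/
def IsGuardSet (T : OrthogonalTerrain n) (S : Finset (Fin n)) : Prop :=
  (∀ g ∈ S, T.IsReflex g) ∧ ∀ c, T.IsConvex c → ∃ g ∈ S, T.Sees g c

/-- A guard set of minimum cardinality. -/
def IsMinGuardSet (T : OrthogonalTerrain n) (S : Finset (Fin n)) : Prop :=
  T.IsGuardSet S ∧ ∀ S' : Finset (Fin n), T.IsGuardSet S' → S.card ≤ S'.card

end OrthogonalTerrain

/-! ### Random access programs with two sorts of cells

A program works with finitely many arrays of natural numbers (used for indices, counters and the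
output) and finitely many arrays of numbers of an ordered field `K` (used for coordinates). It is a
finite text, independent of the field and of the input. There are no operations that turn a number
of `K` into a natural number; such numbers can only be compared. -/

/-- Expressions for natural numbers. `load A a` is the content of cell `a` of array `A`. -/
inductive NExp : Type
  | const (k : ℕ)
  | load (A : ℕ) (a : NExp)
  | add (a b : NExp)
  | sub (a b : NExp)

/-- Expressions for numbers of the field. `load A a` is the content of cell `a` of array `A`. -/
inductive FExp : Type
  | const (k : ℕ)
  | load (A : ℕ) (a : NExp)
  | add (a b : FExp)
  | sub (a b : FExp)
  | mul (a b : FExp)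

/-- Boolean tests. -/
inductive BExp : Type
  | natLt (a b : NExp)
  | fldLt (a b : FExp)
  | not (b : BExp)
  | and (b c : BExp)

/-- Programs. `setNat A a e` and `setFld A a e` store the value of `e` in cell `a` of array `A`. -/
inductive Prog : Type
  | skip
  | setNat (A : ℕ) (a : NExp) (e : NExp)
  | setFld (A : ℕ) (a : NExp) (e : FExp)
  | seq (P Q : Prog)
  | ite (b : BExp) (P Q : Prog)
  | loop (b : BExp) (P : Prog)

/-- The memory: the contents of the arrays. -/
structure Memory (K : Type) where
  nat : ℕ → ℕ → ℕ
  fld : ℕ → ℕ → K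

section Semantics

variable {K : Type} [Field K] [LinearOrder K]

def NExp.eval (σ : Memory K) : NExp → ℕ
  | .const k => k
  | .load A a => σ.nat A (a.eval σ)
  | .add a b => a.eval σ + b.eval σ
  | .sub a b => a.eval σ - b.eval σ

def FExp.eval (σ : Memory K) : FExp → K
  | .const k => (k : K)
  | .load A a => σ.fld A (a.eval σ)
  | .add a b => a.eval σ + b.eval σ
  | .sub a b => a.eval σ - b.eval σ
  | .mul a b => a.eval σ * b.eval σ

def BExp.Holds (σ : Memory K) : BExp → Prop
  | .natLt a b => a.eval σ < b.eval σ
  | .fldLt a b => a.eval σ < b.eval σ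
  | .not b => ¬ b.Holds σ
  | .and b c => b.Holds σ ∧ c.Holds σ

/-- The cost of evaluating an expression: every operation and every access to a cell costs one plus
the number of bits of its result. -/
def NExp.cost (σ : Memory K) : NExp → ℕ
  | .const k => 1 + Nat.size k
  | .load A a => a.cost σ + 1 + Nat.size ((NExp.load A a).eval σ)
  | .add a b => a.cost σ + b.cost σ + 1 + Nat.size ((NExp.add a b).eval σ)
  | .sub a b => a.cost σ + b.cost σ + 1 + Nat.size ((NExp.sub a b).eval σ)

/-- The same for expressions over the field; `w z` is what is charged for the size of `z`. -/
def FExp.cost (w : K → ℕ) (σ : Memory K) : FExp → ℕ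
  | .const k => 1 + w (k : K)
  | .load A a => a.cost σ + 1 + w ((FExp.load A a).eval σ)
  | .add a b => a.cost w σ + b.cost w σ + 1 + w ((FExp.add a b).eval σ)
  | .sub a b => a.cost w σ + b.cost w σ + 1 + w ((FExp.sub a b).eval σ)
  | .mul a b => a.cost w σ + b.cost w σ + 1 + w ((FExp.mul a b).eval σ)

def BExp.cost (w : K → ℕ) (σ : Memory K) : BExp → ℕ
  | .natLt a b => a.cost σ + b.cost σ + 1
  | .fldLt a b => a.cost w σ + b.cost w σ + 1
  | .not b => b.cost w σ + 1
  | .and b c => b.cost w σ + c.cost w σ + 1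

/-- Store `z` in cell `a` of array `A` of natural numbers. -/
def Memory.updNat (σ : Memory K) (A a z : ℕ) : Memory K :=
  { σ with nat := Function.update σ.nat A (Function.update (σ.nat A) a z) }

/-- Store `z` in cell `a` of array `A` of numbers of the field. -/
def Memory.updFld (σ : Memory K) (A a : ℕ) (z : K) : Memory K :=
  { σ with fld := Function.update σ.fld A (Function.update (σ.fld A) a z) }

/-- `Exec w P σ τ c`: started with memory `σ`, the program `P` halts with memory `τ`, and the total
cost of the run is `c`. -/
inductive Exec (w : K → ℕ) : Prog → Memory K → Memory K → ℕ → Prop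
  | skip (σ : Memory K) : Exec w .skip σ σ 1
  | setNat (A : ℕ) (a e : NExp) (σ : Memory K) :
      Exec w (.setNat A a e) σ (σ.updNat A (a.eval σ) (e.eval σ)) (a.cost σ + e.cost σ + 1)
  | setFld (A : ℕ) (a : NExp) (e : FExp) (σ : Memory K) :
      Exec w (.setFld A a e) σ (σ.updFld A (a.eval σ) (e.eval σ)) (a.cost σ + e.cost w σ + 1)
  | seq {P Q : Prog} {σ ρ τ : Memory K} {c d : ℕ} :
      Exec w P σ ρ c → Exec w Q ρ τ d → Exec w (.seq P Q) σ τ (c + d)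
  | iteTrue {b : BExp} {P Q : Prog} {σ τ : Memory K} {c : ℕ} :
      b.Holds σ → Exec w P σ τ c → Exec w (.ite b P Q) σ τ (b.cost w σ + c + 1)
  | iteFalse {b : BExp} {P Q : Prog} {σ τ : Memory K} {c : ℕ} :
      ¬ b.Holds σ → Exec w Q σ τ c → Exec w (.ite b P Q) σ τ (b.cost w σ + c + 1)
  | loopDone {b : BExp} {P : Prog} {σ : Memory K} :
      ¬ b.Holds σ → Exec w (.loop b P) σ σ (b.cost w σ + 1)
  | loopStep {b : BExp} {P : Prog} {σ ρ τ : Memory K} {c d : ℕ} :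
      b.Holds σ → Exec w P σ ρ c → Exec w (.loop b P) ρ τ d →
      Exec w (.loop b P) σ τ (b.cost w σ + c + d + 1)

/-- The initial memory for a chain of `n` vertices with the given coordinates: cell `0` of array `0`
of natural numbers holds `n`, arrays `0` and `1` of field numbers hold the abscissas and the
ordinates, and all other cells hold `0`. -/
def inputMemory {n : ℕ} (x y : Fin n → K) : Memory K where
  nat A a := if A = 0 ∧ a = 0 then n else 0
  fld A a := if h : a < n then (if A = 0 then x ⟨a, h⟩ else if A = 1 then y ⟨a, h⟩ else 0) else 0

/-- The set of vertices that is read off a final memory: the vertices `i` for which cell `i` of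
array `2` of natural numbers holds `1`. -/
def outputSet (n : ℕ) (τ : Memory K) : Finset (Fin n) :=
  Finset.univ.filter fun i => τ.nat 2 i = 1

/-- The final memory holds a correct answer: cell `0` of array `1` of natural numbers
is `1` and the output is a guard set of minimum cardinality, or this cell is `0` and
there is no guard set at all. -/
def CorrectOutput {n : ℕ} (T : OrthogonalTerrain n) (τ : Memory K) : Prop :=
  (τ.nat 1 0 = 1 ∧ T.IsMinGuardSet (outputSet n τ)) ∨
  (τ.nat 1 0 = 0 ∧ ∀ S : Finset (Fin n), ¬ T.IsGuardSet S)

end Semantics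

/-- The number of bits of a rational number (numerator and denominator in lowest terms). -/
def ratBits (q : ℚ) : ℕ := Nat.size q.num.natAbs + Nat.size q.den

/-- The program solves the vertex terrain guarding problem on all orthogonal terrains with real
coordinates, with unit cost for the real operations, in time polynomial in the number of vertices. -/
def SolvesVTGRealRAM (P : Prog) : Prop :=
  ∃ p : Polynomial ℕ, ∀ (n : ℕ) (T : OrthogonalTerrain n),
    ∃ (τ : Memory ℝ) (c : ℕ), Exec (fun _ => 0) P (inputMemory T.x T.y) τ c ∧
      c ≤ p.eval n ∧ CorrectOutput T τ

/-- The program solves the vertex terrain guarding problem on all orthogonal terrains with rational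
coordinates, with every operation charged by the number of bits of its result, in time polynomial
in the number of bits of the input. -/
def SolvesVTGBitCost (P : Prog) : Prop :=
  ∃ p : Polynomial ℕ, ∀ (n : ℕ) (T : OrthogonalTerrain n) (x y : Fin n → ℚ),
    (∀ i, T.x i = (x i : ℝ)) → (∀ i, T.y i = (y i : ℝ)) →
    ∃ (τ : Memory ℚ) (c : ℕ), Exec ratBits P (inputMemory x y) τ c ∧
      c ≤ p.eval (∑ i, (ratBits (x i) + ratBits (y i))) ∧ CorrectOutput T τ

end VTG

/-!
A reflex vertex of even index has its plateau on the left, and a segment from it to the left, or to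
a convex vertex that is not at the right end of its floor, meets the terrain. Hence reflex vertices
of even index only see convex vertices of even index, to their right and below them
(`OrthogonalTerrain.Sees.even_overlooks`), and, by reflection, the same holds for odd indices and
the other direction. So the problem splits into two independent one-sided problems.

On one side, visibility amounts to the condition that all vertices in between lie strictly below the
line of sight (`Overlooks`), which needs only polynomial arithmetic of bounded depth, and the order
claim holds (`Overlooks.cross`): if `a < b < c < d`, and `a` sees `c` and `b` sees `d`, then `a`
sees `d`. Therefore, among the guards of the leftmost target that is not seen yet, the leftmost one
sees all the later targets that any of the others sees, and the greedy method may take it. The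
targets for which guards were added are witnesses of optimality: no guard sees two of them
(`Greedy`), within one side by the order claim and across the sides by parity
(`OrthogonalTerrain.isMinGuardSet_of_greedy`).

The program runs the greedy method for the terrain and then for its mirror image, which is addressed
through the index `n - 1 - i`. It never stores a coordinate number; the tests only compute
differences and products of two differences of coordinates. Therefore a single bound `B` on the size
of these numbers gives a cost bound polynomial in `n` and `B` (`exec_guardProg`), with `B = 0` for
unit costs and `B = O(s)` for rational coordinates of total bit length `s`. The correctness proof
transfers the comparisons from the field of the program to the reals along an order embedding.
-/

namespace VTG

/-! ### Visibility as a condition on the vertices in between -/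

section Order

variable {F : Type*} [Field F] [LinearOrder F]

/-- For `X g < X c`: the vertex `k` lies strictly below the line through the vertices `g` and `c`
(the equation of the line is multiplied by `X c - X g`, which avoids division). -/
def Below (X Y : ℕ → F) (g c k : ℕ) : Prop :=
  (Y k - Y c) * (X c - X g) < (Y g - Y c) * (X c - X k)

/-- The combinatorial form of visibility: the vertex `g` is higher than `c`, and all the vertices
with an index between those of `g` and `c` lie strictly below the line `gc`. -/
def Overlooks (X Y : ℕ → F) (g c : ℕ) : Prop :=
  Y c < Y g ∧ ∀ k, g < k → k < c → Below X Y g c k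

/-- The vertex `2 a` is a reflex vertex to the left of the vertex `2 b` and overlooks it. -/
def Guards (X Y : ℕ → F) (a b : ℕ) : Prop :=
  a < b ∧ Y (2 * a + 1) < Y (2 * a) ∧ Overlooks X Y (2 * a) (2 * b)

/-- Visibility is decided by comparisons of polynomials in the coordinates, so it is preserved by
order embeddings of fields. -/
theorem Guards.map {G : Type*} [Field G] [LinearOrder G] {φ : F →+* G} (hφ : StrictMono φ)
    {X Y : ℕ → F} {X' Y' : ℕ → G} {a b n : ℕ} (hb : 2 * b < n) (hX : ∀ k, k < n → X' k = φ (X k))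
    (hY : ∀ k, k < n → Y' k = φ (Y k)) : Guards X' Y' a b ↔ Guards X Y a b := by
  refine and_congr_right fun hab => ?_
  rw [Overlooks, Overlooks, hY _ (by omega), hY _ (by omega), hY (2 * b) hb, hφ.lt_iff_lt,
    hφ.lt_iff_lt]
  refine and_congr_right fun _ => and_congr_right fun _ => forall_congr' fun k =>
    imp_congr_right fun hk => imp_congr_right fun hk' => ?_
  rw [Below, hY k (by omega), hY (2 * b) hb, hY (2 * a) (by omega), hX (2 * b) hb,
    hX (2 * a) (by omega), hX k (by omega), ← map_sub, ← map_sub, ← map_sub, ← map_sub,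
    ← map_mul, ← map_mul, hφ.lt_iff_lt, Below]

variable [IsStrictOrderedRing F]

theorem below_iff_slope {X Y : ℕ → F} {g c k : ℕ} (h : X g < X c) :
    Below X Y g c k ↔ Y k < Y c + (Y g - Y c) / (X c - X g) * (X c - X k) := by
  have h0 : 0 < X c - X g := sub_pos.2 h
  have e : (Y g - Y c) / (X c - X g) * (X c - X k) = (Y g - Y c) * (X c - X k) / (X c - X g) := by
    ring
  rw [Below, ← sub_lt_iff_lt_add', e, lt_div_iff₀ h0]

/-- The order claim: if two lines of sight `ac` and `bd` with `a < b < c < d` cross, then `a` also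
overlooks `d`. -/
theorem Overlooks.cross {X Y : ℕ → F} {a b c d : ℕ} (hab : a < b) (hbc : b < c) (hcd : c < d)
    (xab : X a < X b) (xbc : X b < X c) (xcd : X c < X d)
    (hmono : ∀ i j, i ≤ j → j < d → X i ≤ X j) (hlt : ∀ k, k < d → X k < X d)
    (h1 : Overlooks X Y a c) (h2 : Overlooks X Y b d) : Overlooks X Y a d := by
  have xac := xab.trans xbc
  have xbd := xbc.trans xcd
  have xad := xac.trans xcd
  have B1 := fun k hk hk' => (below_iff_slope xac).1 (h1.2 k hk hk')
  have B2 := fun k hk hk' => (below_iff_slope xbd).1 (h2.2 k hk hk')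
  have s1 : (Y a - Y c) / (X c - X a) * (X c - X a) = Y a - Y c :=
    div_mul_cancel₀ _ (sub_pos.2 xac).ne'
  have s2 : (Y b - Y d) / (X d - X b) * (X d - X b) = Y b - Y d :=
    div_mul_cancel₀ _ (sub_pos.2 xbd).ne'
  have s3 : (Y a - Y d) / (X d - X a) * (X d - X a) = Y a - Y d :=
    div_mul_cancel₀ _ (sub_pos.2 xad).ne'
  have p2 : 0 < (Y b - Y d) / (X d - X b) := div_pos (sub_pos.2 h2.1) (sub_pos.2 xbd)
  have e3 : ∀ k, Below X Y a d k ↔ _ := fun k => below_iff_slope xad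
  rw [Overlooks]
  simp only [e3]
  -- `m1`, `m2` and `m3` are the absolute slopes of the descending lines `ac`, `bd` and `ad`
  generalize (Y a - Y c) / (X c - X a) = m1 at *
  generalize (Y b - Y d) / (X d - X b) = m2 at *
  generalize (Y a - Y d) / (X d - X a) = m3 at *
  have hb := B1 b hab hbc
  have hc := B2 c hbc hcd
  have m21 : m2 < m1 := by
    by_contra hn
    nlinarith [mul_le_mul_of_nonneg_right (not_lt.1 hn) (sub_pos.2 xbc).le]
  have m23 : m2 < m3 := by
    by_contra hn
    nlinarith [mul_le_mul_of_nonneg_right (not_lt.1 hn) (sub_pos.2 xad).le,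
      mul_lt_mul_of_pos_right m21 (sub_pos.2 xab)]
  have hc3 : Y c < Y d + m3 * (X d - X c) := by
    nlinarith [mul_lt_mul_of_pos_right m23 (sub_pos.2 xcd)]
  have m31 : m3 < m1 := by
    by_contra hn
    nlinarith [mul_le_mul_of_nonneg_right (not_lt.1 hn) (sub_pos.2 xac).le]
  refine ⟨by nlinarith [mul_pos (p2.trans m23) (sub_pos.2 xad)], fun k hk hkd => ?_⟩
  -- the line `ad` is above `ac` to the right of `a`, and above `bd` to the left of `d`
  rcases lt_trichotomy k c with h | rfl | h
  · have := B1 k hk h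
    nlinarith [mul_le_mul_of_nonneg_right m31.le (sub_nonneg.2 (hmono a k hk.le hkd))]
  · exact hc3
  · have := B2 k (hbc.trans h) hkd
    nlinarith [mul_lt_mul_of_pos_right m23 (sub_pos.2 (hlt k hkd))]

end Order

/-! ### The geometry of orthogonal terrains -/

namespace OrthogonalTerrain

variable {n : ℕ} (T : OrthogonalTerrain n)

/-- The abscissas as a function on the natural numbers (`0` outside the range of indices). -/
noncomputable def X (k : ℕ) : ℝ := if h : k < n then T.x ⟨k, h⟩ else 0

/-- The ordinates as a function on the natural numbers (`0` outside the range of indices). -/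
noncomputable def Y (k : ℕ) : ℝ := if h : k < n then T.y ⟨k, h⟩ else 0

theorem X_val (i : Fin n) : T.X i = T.x i := by simp [X]

theorem Y_val (i : Fin n) : T.Y i = T.y i := by simp [Y]

theorem X_eq {k : ℕ} (h : k < n) : T.X k = T.x ⟨k, h⟩ := by simp [X, h]

theorem Y_eq {k : ℕ} (h : k < n) : T.Y k = T.y ⟨k, h⟩ := by simp [Y, h]

theorem succ_lt (T : OrthogonalTerrain n) {k : ℕ} (h : k < n) (hk : Even k) : k + 1 < n := by
  have := T.even
  grind

theorem X_vert {k : ℕ} (h : k < n) (hk : Even k) : T.X (k + 1) = T.X k := by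
  have h' := T.succ_lt h hk
  rw [T.X_eq h, T.X_eq h', (T.vertical ⟨k, h⟩ ⟨k + 1, h'⟩ rfl hk).1]

theorem X_horiz {k : ℕ} (h : k + 1 < n) (hk : Odd k) : T.X k < T.X (k + 1) := by
  rw [T.X_eq h, T.X_eq (by omega : k < n)]
  exact (T.horizontal ⟨k, by omega⟩ ⟨k + 1, h⟩ rfl hk).1

theorem Y_horiz {k : ℕ} (h : k + 1 < n) (hk : Odd k) : T.Y (k + 1) = T.Y k := by
  rw [T.Y_eq h, T.Y_eq (by omega : k < n)]
  exact (T.horizontal ⟨k, by omega⟩ ⟨k + 1, h⟩ rfl hk).2.symm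

theorem X_mono {i j : ℕ} (hij : i ≤ j) (hj : j < n) : T.X i ≤ T.X j := by
  induction j, hij using Nat.le_induction with
  | base => exact le_rfl
  | succ j hij ih =>
    refine (ih (by omega)).trans ?_
    rcases Nat.even_or_odd j with h | h
    · exact (T.X_vert (by omega) h).ge
    · exact (T.X_horiz hj h).le

theorem X_lt_even {i j : ℕ} (hij : i < j) (hj : j < n) (h : Even j) : T.X i < T.X j := by
  obtain ⟨m, rfl⟩ : ∃ m, j = m + 1 := ⟨j - 1, by omega⟩
  exact (T.X_mono (by omega : i ≤ m) (by omega)).trans_lt (T.X_horiz hj (by grind))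

theorem X_lt_odd {i j : ℕ} (hij : i < j) (hj : j < n) (h : Odd i) : T.X i < T.X j :=
  (T.X_horiz (by omega) h).trans_le (T.X_mono (by omega : i + 1 ≤ j) hj)

theorem isReflex_even {u : Fin n} (h : Even (u : ℕ)) : T.IsReflex u ↔ T.Y (u + 1) < T.Y u := by
  have h' := T.succ_lt u.2 h
  rw [T.Y_eq h', T.Y_val]
  constructor
  · rintro ⟨j, ⟨-, hj⟩ | ⟨hj, hu⟩, hlt⟩
    · rwa [show j = ⟨u + 1, h'⟩ from Fin.ext hj] at hlt
    · grind
  · exact fun hlt => ⟨⟨u + 1, h'⟩, Or.inl ⟨h, rfl⟩, hlt⟩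

theorem isConvex_even {u : Fin n} (h : Even (u : ℕ)) : T.IsConvex u ↔ T.Y u < T.Y (u + 1) := by
  have h' := T.succ_lt u.2 h
  rw [T.Y_eq h', T.Y_val]
  constructor
  · rintro ⟨j, ⟨-, hj⟩ | ⟨hj, hu⟩, hlt⟩
    · rwa [show j = ⟨u + 1, h'⟩ from Fin.ext hj] at hlt
    · grind
  · exact fun hlt => ⟨⟨u + 1, h'⟩, Or.inl ⟨h, rfl⟩, hlt⟩

theorem mem_carrier_edge {i : ℕ} (h : i + 1 < n) {t : ℝ} (h0 : 0 ≤ t) (h1 : t ≤ 1) :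
    (T.X i + t * (T.X (i + 1) - T.X i), T.Y i + t * (T.Y (i + 1) - T.Y i)) ∈ T.carrier := by
  refine Or.inr ⟨⟨i, by omega⟩, ⟨i + 1, h⟩, rfl, ?_⟩
  rw [segment_eq_image']
  refine ⟨t, ⟨h0, h1⟩, ?_⟩
  simp [pt, T.X_eq h, T.Y_eq h, T.X_eq (by omega : i < n), T.Y_eq (by omega : i < n)]

theorem vertex_mem_carrier {k : ℕ} (h : k < n) : (T.X k, T.Y k) ∈ T.carrier := by
  rcases Nat.even_or_odd k with hk | hk
  · simpa using T.mem_carrier_edge (T.succ_lt h hk) le_rfl zero_le_one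
  · obtain ⟨m, rfl⟩ : ∃ m, k = m + 1 := ⟨k - 1, by grind⟩
    simpa using T.mem_carrier_edge h zero_le_one le_rfl

/-- Near a vertex of even index, the horizontal edge or ray to the left of it. -/
theorem exists_left_edge {k : ℕ} (h : k < n) (hk : Even k) :
    ∃ δ > 0, ∀ t, 0 ≤ t → t ≤ δ → (T.X k - t, T.Y k) ∈ T.carrier := by
  rcases Nat.eq_zero_or_pos k with rfl | h0
  · refine ⟨1, one_pos, fun t ht _ => Or.inl (Or.inl ⟨?_, ?_⟩)⟩
    · simpa [first, T.X_eq T.pos] using ht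
    · simp [first, T.Y_eq T.pos]
  · obtain ⟨m, rfl⟩ : ∃ m, k = m + 1 := ⟨k - 1, by omega⟩
    have hm : Odd m := by grind
    have hx := sub_pos.2 (T.X_horiz h hm)
    refine ⟨_, hx, fun t ht ht' => ?_⟩
    have hle : t / (T.X (m + 1) - T.X m) ≤ 1 := (div_le_one hx).2 ht'
    have hc : t / (T.X (m + 1) - T.X m) * (T.X (m + 1) - T.X m) = t := div_mul_cancel₀ _ hx.ne'
    have := T.mem_carrier_edge h (t := 1 - t / (T.X (m + 1) - T.X m)) (by linarith)
      (by linarith [div_nonneg ht hx.le])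
    rw [sub_mul, hc, T.Y_horiz h hm] at this
    rw [T.Y_horiz h hm]
    convert this using 2 <;> ring

/-- Near a vertex of odd index, the horizontal edge or ray to the right of it. -/
theorem exists_right_edge {k : ℕ} (h : k < n) (hk : Odd k) :
    ∃ δ > 0, ∀ t, 0 ≤ t → t ≤ δ → (T.X k + t, T.Y k) ∈ T.carrier := by
  rcases (show k + 1 ≤ n from h).lt_or_eq with h1 | h1
  · have hx := sub_pos.2 (T.X_horiz h1 hk)
    refine ⟨_, hx, fun t ht ht' => ?_⟩
    have hle : t / (T.X (k + 1) - T.X k) ≤ 1 := (div_le_one hx).2 ht'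
    have hc : t / (T.X (k + 1) - T.X k) * (T.X (k + 1) - T.X k) = t := div_mul_cancel₀ _ hx.ne'
    have := T.mem_carrier_edge h1 (div_nonneg ht hx.le) hle
    rw [hc, T.Y_horiz h1 hk] at this
    simpa using this
  · have hl : T.last = ⟨k, h⟩ := Fin.ext (by simp [last]; omega)
    refine ⟨1, one_pos, fun t ht _ => Or.inl (Or.inr ⟨?_, ?_⟩)⟩
    · simpa [hl, T.X_eq h] using ht
    · simp [hl, T.Y_eq h]

theorem sees_iff {u v : Fin n} : T.Sees u v ↔ ∀ t : ℝ, 0 < t → t < 1 →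
    T.StrictlyAbove (T.X u + t * (T.X v - T.X u), T.Y u + t * (T.Y v - T.Y u)) := by
  simp only [Sees, openSegment_eq_image', Set.forall_mem_image, pt, X_val, Y_val]
  exact ⟨fun h t h0 h1 => h ⟨h0, h1⟩, fun h t ht => h t ht.1 ht.2⟩

/-- If a line stays above the height `h` to the right of the origin, then its height at the origin
is at least `h`, and its slope is positive in the case of equality. -/
theorem _root_.VTG.line_above {h y s δ : ℝ} (hδ : 0 < δ)
    (H : ∀ t, 0 < t → t < δ → h < y + t * s) : h ≤ y ∧ (h = y → 0 < s) := by
  constructor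
  · by_contra! hn
    have hs : 0 < |s| + 1 := by positivity
    have hd : 0 < h - y := sub_pos.2 hn
    have h1 := H (min (δ / 2) ((h - y) / (|s| + 1))) (by positivity)
      ((min_le_left _ _).trans_lt (half_lt_self hδ))
    have h2 := min_le_right (δ / 2) ((h - y) / (|s| + 1))
    have h3 : 0 < min (δ / 2) ((h - y) / (|s| + 1)) := by positivity
    rw [le_div_iff₀ hs] at h2
    nlinarith [le_abs_self s]
  · rintro rfl
    have := H (δ / 2) (by positivity) (half_lt_self hδ)
    by_contra! hn
    nlinarith

/-- A line of sight that leaves `u` to the left cannot be below the horizontal edge there; `k` is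
the vertex of even index on the vertical line through `u`. -/
theorem sees_left {u v : Fin n} (h : T.Sees u v) (hx : T.X v < T.X u) {k : ℕ} (hk : k < n)
    (hev : Even k) (hxk : T.X k = T.X u) :
    T.Y k ≤ T.Y u ∧ (T.Y k = T.Y u → T.Y u < T.Y v) := by
  obtain ⟨δ, hδ, H⟩ := T.exists_left_edge hk hev
  have hd := sub_pos.2 hx
  have := line_above (h := T.Y k) (y := T.Y u) (s := T.Y v - T.Y u)
    (δ := min 1 (δ / (T.X u - T.X v))) (by positivity) fun t ht ht' => by
      have h1 := (lt_div_iff₀ hd).1 (ht'.trans_le (min_le_right _ _))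
      refine T.sees_iff.1 h t ht (ht'.trans_le (min_le_left _ _)) _
        (H (t * (T.X u - T.X v)) (by positivity) h1.le) ?_
      simp only [hxk]
      ring
  exact ⟨this.1, fun e => sub_pos.1 (this.2 e)⟩

/-- The mirror image of `sees_left`; here `k` is the vertex of odd index on the vertical line
through `u`. -/
theorem sees_right {u v : Fin n} (h : T.Sees u v) (hx : T.X u < T.X v) {k : ℕ} (hk : k < n)
    (hodd : Odd k) (hxk : T.X k = T.X u) :
    T.Y k ≤ T.Y u ∧ (T.Y k = T.Y u → T.Y u < T.Y v) := by
  obtain ⟨δ, hδ, H⟩ := T.exists_right_edge hk hodd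
  have hd := sub_pos.2 hx
  have := line_above (h := T.Y k) (y := T.Y u) (s := T.Y v - T.Y u)
    (δ := min 1 (δ / (T.X v - T.X u))) (by positivity) fun t ht ht' => by
      have h1 := (lt_div_iff₀ hd).1 (ht'.trans_le (min_le_right _ _))
      refine T.sees_iff.1 h t ht (ht'.trans_le (min_le_left _ _)) _
        (H (t * (T.X v - T.X u)) (by positivity) h1.le) ?_
      simp only [hxk]
  exact ⟨this.1, fun e => sub_pos.1 (this.2 e)⟩

theorem Sees.symm {T : OrthogonalTerrain n} {u v : Fin n} (h : T.Sees u v) : T.Sees v u := by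
  intro p hp
  rw [openSegment_symm] at hp
  exact h p hp

/-- A reflex vertex of even index has its plateau to the left, hence it only sees convex vertices
of even index to the right of it. -/
theorem Sees.even_overlooks {T : OrthogonalTerrain n} {u v : Fin n} (h : T.Sees u v)
    (hu : Even (u : ℕ)) (hr : T.IsReflex u) (hv : T.IsConvex v) :
    Even (v : ℕ) ∧ (u : ℕ) < v ∧ Overlooks T.X T.Y u v := by
  have hu1 := T.succ_lt u.2 hu
  rw [T.isReflex_even hu] at hr
  -- the two vertices on the vertical line through `v`
  obtain ⟨e, he, heven, hex, hex', hv1, hv2⟩ : ∃ e, ∃ _ : e < n, Even e ∧ T.X e = T.X v ∧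
      T.X (e + 1) = T.X v ∧ ((v : ℕ) = e ∧ T.Y v < T.Y (e + 1) ∨
        (v : ℕ) = e + 1 ∧ T.Y v < T.Y e) ∧ T.Y v ≤ T.Y (e + 1) := by
    rcases Nat.even_or_odd (v : ℕ) with hp | hp
    · have := (T.isConvex_even hp).1 hv
      exact ⟨v, v.2, hp, rfl, T.X_vert v.2 hp, Or.inl ⟨rfl, this⟩, this.le⟩
    · obtain ⟨j, ⟨hj, _⟩ | ⟨hj, hj'⟩, hlt⟩ := hv
      · grind
      · rw [← T.Y_val, ← T.Y_val] at hlt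
        refine ⟨j, j.2, hj, ?_, ?_, Or.inr ⟨hj', hlt⟩, ?_⟩
        · rw [hj', T.X_vert j.2 hj]
        · rw [hj']
        · rw [hj']
  have hxlt : T.X u < T.X v := by
    rcases lt_trichotomy (T.X v) (T.X u) with hx | hx | hx
    · -- the line of sight leaves `u` upwards to the left and so reaches `v` from below
      have h1 := (T.sees_left h hx u.2 hu rfl).2 rfl
      have h2 := T.sees_right h.symm hx (T.succ_lt he heven) (by grind) hex'
      have h3 := h2.2 (le_antisymm h2.1 hv2)
      linarith
    · exfalso
      have hue : (u : ℕ) = e := by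
        by_contra hne
        rcases Nat.lt_or_gt_of_ne hne with hlt | hlt
        · have := T.X_lt_even hlt he heven
          linarith
        · have := T.X_lt_even hlt u.2 hu
          linarith
      rcases hv1 with ⟨h1, h2⟩ | ⟨h1, h2⟩
      · rw [← hue] at h1 h2
        rw [h1] at h2
        linarith
      · -- both endpoints of a vertical edge: the segment is part of the terrain
        have h3 := T.sees_iff.1 h (1 / 2) (by norm_num) (by norm_num) _
          (T.mem_carrier_edge hu1 (t := 1 / 2) (by norm_num) (by norm_num))
        rw [h1, hue] at h3
        exact lt_irrefl _ (h3 rfl)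
    · exact hx
  have huv : (u : ℕ) < v := by
    by_contra hn
    exact absurd (T.X_mono (not_lt.1 hn) u.2) (not_le.2 hxlt)
  have h1 := T.sees_left h.symm hxlt he heven hex
  have hve : (v : ℕ) = e := by
    rcases hv1 with ⟨h2, _⟩ | ⟨_, h2⟩
    · exact h2
    · linarith [h1.1]
  have hveven : Even (v : ℕ) := hve ▸ heven
  refine ⟨hveven, huv, h1.2 (by rw [hve]), fun k hk hk' => ?_⟩
  have hkn : k < n := hk'.trans v.2
  rcases (T.X_mono hk.le hkn).lt_or_eq with hx | hx
  · have hkv := T.X_lt_even hk' v.2 hveven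
    have hd := sub_pos.2 hxlt
    have h2 := T.sees_iff.1 h ((T.X k - T.X u) / (T.X v - T.X u)) (div_pos (sub_pos.2 hx) hd)
      ((div_lt_one hd).2 (by linarith)) _ (T.vertex_mem_carrier hkn)
    rw [div_mul_cancel₀ _ hd.ne'] at h2
    have h3 := h2 (by simp)
    simp only at h3
    have h4 := mul_lt_mul_of_pos_right h3 hd
    rw [add_mul, mul_right_comm, div_mul_cancel₀ _ hd.ne'] at h4
    rw [Below]
    nlinarith
  · have hk1 : k = u + 1 := by
      by_contra hne
      have := T.X_lt_odd (by omega : (u : ℕ) + 1 < k) hkn (by grind)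
      rw [T.X_vert u.2 hu] at this
      linarith
    subst hk1
    rw [Below, ← hx]
    exact mul_lt_mul_of_pos_right (by linarith) (sub_pos.2 hxlt)

theorem sees_of_overlooks {u v : Fin n} (hv : Even (v : ℕ))
    (huv : (u : ℕ) < v) (h : Overlooks T.X T.Y u v) : T.Sees u v := by
  rw [sees_iff]
  intro t h0 h1 q hq hqx
  have hxlt := T.X_lt_even huv v.2 hv
  have hd := sub_pos.2 hxlt
  simp only at hqx ⊢
  have hq1 : T.X u < q.1 := by nlinarith
  have hq2 : q.1 < T.X v := by nlinarith
  -- a vertex in between that is not to the left of `q` is lower than the line of sight at `q`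
  have key : ∀ k : ℕ, (u : ℕ) < k → k < v → q.1 ≤ T.X k →
      T.Y k < T.Y u + t * (T.Y v - T.Y u) := by
    intro k hk hk' hqk
    have hB := h.2 k hk hk'
    rw [Below] at hB
    have hY := h.1
    have : (T.Y k - T.Y v) * (T.X v - T.X u) <
        (T.Y u - T.Y v) * (1 - t) * (T.X v - T.X u) := by
      nlinarith [mul_le_mul_of_nonneg_left hqk (sub_pos.2 hY).le]
    have := lt_of_mul_lt_mul_right this hd.le
    linarith
  rcases hq with (⟨hq, -⟩ | ⟨hq, -⟩) | ⟨i, j, hij, hq⟩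
  · rw [← T.X_val] at hq
    have := T.X_mono (show ((T.first : Fin n) : ℕ) ≤ u by simp [first]) u.2
    linarith
  · rw [← T.X_val] at hq
    have := T.X_mono (show (v : ℕ) ≤ ((T.last : Fin n) : ℕ) by simp [last]; omega) T.last.2
    linarith
  · rw [segment_eq_image'] at hq
    obtain ⟨s, ⟨hs0, hs1⟩, rfl⟩ := hq
    simp only [pt, ← T.X_val, ← T.Y_val, Prod.fst_add, Prod.snd_add, Prod.smul_fst, Prod.smul_snd,
      Prod.fst_sub, Prod.snd_sub, smul_eq_mul, hij] at hqx hq1 hq2 key ⊢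
    have hi1 : (i : ℕ) + 1 < n := hij ▸ j.2
    rcases Nat.even_or_odd (i : ℕ) with hi | hi
    · rw [T.X_vert i.2 hi, sub_self, mul_zero, add_zero] at hqx hq1 hq2 key
      have hui : (u : ℕ) < i := by
        by_contra hn
        exact absurd (T.X_mono (not_lt.1 hn) u.2) (not_le.2 hq1)
      have hiv : (i : ℕ) < v := by
        by_contra hn
        exact absurd (T.X_mono (not_lt.1 hn) i.2) (not_le.2 hq2)
      have k1 := key i hui hiv le_rfl
      have k2 := key (i + 1) (by omega) (by grind) (T.X_vert i.2 hi).ge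
      rcases hs1.lt_or_eq with hs1 | rfl
      · nlinarith
      · linarith
    · have hxi := T.X_horiz hi1 hi
      rw [T.Y_horiz hi1 hi, sub_self, mul_zero, add_zero]
      have hui : (u : ℕ) < i + 1 := by
        by_contra hn
        have := T.X_mono (not_lt.1 hn) u.2
        nlinarith
      have hiv : (i : ℕ) < v := by
        by_contra hn
        have := T.X_mono (not_lt.1 hn) i.2
        nlinarith
      rcases (show (i : ℕ) + 1 ≤ v from hiv).lt_or_eq with h2 | h2
      · have := key (i + 1) (by omega) h2 (by nlinarith)
        rwa [T.Y_horiz hi1 hi] at this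
      · have hY := h.1
        rw [← h2, T.Y_horiz hi1 hi] at hY ⊢
        nlinarith

/-! ### Mirror images -/

/-- The image of a terrain under the reflection `(x, y) ↦ (-x, y)`. -/
noncomputable def mirror : OrthogonalTerrain n where
  x i := -T.x i.rev
  y i := T.y i.rev
  pos := T.pos
  even := T.even
  vertical i j hij hi := by
    have h := T.even
    have := T.vertical j.rev i.rev (by simp only [Fin.val_rev]; omega)
      (by simp only [Fin.val_rev]; grind)
    exact ⟨by rw [this.1], this.2.symm⟩
  horizontal i j hij hi := by
    have h := T.even
    have := T.horizontal j.rev i.rev (by simp only [Fin.val_rev]; omega)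
      (by simp only [Fin.val_rev]; grind)
    exact ⟨by linarith [this.1], this.2.symm⟩

theorem mirror_mirror : T.mirror.mirror = T := by
  cases T
  simp [mirror]

theorem pt_mirror (i : Fin n) : T.mirror.pt i = (-(T.pt i.rev).1, (T.pt i.rev).2) := rfl

theorem mem_carrier_mirror {p : ℝ × ℝ} (h : p ∈ T.carrier) : (-p.1, p.2) ∈ T.mirror.carrier := by
  have hf : T.first.rev = T.last := Fin.ext (by simp [first, last, Fin.val_rev])
  have hl : T.last.rev = T.first := by rw [← hf, Fin.rev_rev]
  rcases h with (⟨h1, h2⟩ | ⟨h1, h2⟩) | ⟨i, j, hij, h⟩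
  · refine Or.inl (Or.inr ⟨?_, ?_⟩)
    · change -T.x T.last.rev ≤ _
      rw [hl]
      exact neg_le_neg h1
    · change _ = T.y T.last.rev
      rw [hl]
      exact h2
  · refine Or.inl (Or.inl ⟨?_, ?_⟩)
    · change _ ≤ -T.x T.first.rev
      rw [hf]
      exact neg_le_neg h1
    · change _ = T.y T.first.rev
      rw [hf]
      exact h2
  · refine Or.inr ⟨j.rev, i.rev, by simp only [Fin.val_rev]; omega, ?_⟩
    rw [segment_symm]
    rw [segment_eq_image'] at h ⊢
    obtain ⟨t, ht, rfl⟩ := h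
    refine ⟨t, ht, ?_⟩
    simp only [pt_mirror, Fin.rev_rev]
    ext
    · simp
      ring
    · simp

theorem StrictlyAbove.of_mirror {T : OrthogonalTerrain n} {p : ℝ × ℝ}
    (h : T.mirror.StrictlyAbove (-p.1, p.2)) : T.StrictlyAbove p := fun q hq hqp =>
  h (-q.1, q.2) (T.mem_carrier_mirror hq) (by simp [hqp])

theorem Sees.of_mirror {T : OrthogonalTerrain n} {u v : Fin n} (h : T.mirror.Sees u v) :
    T.Sees u.rev v.rev := by
  rw [sees_iff] at h ⊢
  intro t h0 h1
  refine StrictlyAbove.of_mirror ?_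
  convert h t h0 h1 using 2
  · rw [X_val, X_val, X_val, X_val]
    simp only [mirror]
    ring
  · rw [Y_val, Y_val, Y_val, Y_val]
    rfl

theorem sees_mirror {u v : Fin n} : T.mirror.Sees u v ↔ T.Sees u.rev v.rev := by
  refine ⟨Sees.of_mirror, fun h => ?_⟩
  rw [← T.mirror_mirror] at h
  simpa using h.of_mirror

theorem verticalEdge_mirror {u v : Fin n} :
    T.mirror.VerticalEdge u v ↔ T.VerticalEdge u.rev v.rev := by
  have := T.even
  simp only [VerticalEdge, Fin.val_rev]
  grind

theorem isReflex_mirror {u : Fin n} : T.mirror.IsReflex u ↔ T.IsReflex u.rev := by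
  simp only [IsReflex, verticalEdge_mirror]
  exact ⟨fun ⟨j, h⟩ => ⟨j.rev, h⟩, fun ⟨j, h⟩ => ⟨j.rev, by simpa [mirror] using h⟩⟩

theorem isConvex_mirror {u : Fin n} : T.mirror.IsConvex u ↔ T.IsConvex u.rev := by
  simp only [IsConvex, verticalEdge_mirror]
  exact ⟨fun ⟨j, h⟩ => ⟨j.rev, h⟩, fun ⟨j, h⟩ => ⟨j.rev, by simpa [mirror] using h⟩⟩

end OrthogonalTerrain

/-! ### Greedy choice of guards on one side -/

/-- The state of the greedy method for a relation `V` (`V a b`: the guard `a` sees the target `b`)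
after the targets below `i` have been processed. `S` is the set of chosen guards, and `W` is the set
of witnesses, that is, of targets for which a guard was added. No guard sees two witnesses, and any
later target seen by a guard of a witness is already seen by a chosen guard. -/
structure Greedy (V : ℕ → ℕ → Prop) (C : ℕ → Prop) (N i : ℕ) (S W : Finset ℕ) : Prop where
  card_le : S.card ≤ W.card
  useful : ∀ a ∈ S, ∃ b < N, V a b
  target : ∀ b ∈ W, b < i ∧ C b
  indep : ∀ b ∈ W, ∀ b' ∈ W, ∀ a, V a b → V a b' → b = b'
  dom : ∀ b ∈ W, ∀ a d, V a b → b < d → d < N → V a d → ∃ a' ∈ S, V a' d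

theorem Greedy.empty (V : ℕ → ℕ → Prop) (C : ℕ → Prop) (N : ℕ) : Greedy V C N 0 ∅ ∅ := by
  constructor <;> simp

theorem Greedy.succ {V : ℕ → ℕ → Prop} {C : ℕ → Prop} {N i : ℕ} {S W : Finset ℕ}
    (h : Greedy V C N i S W) : Greedy V C N (i + 1) S W :=
  ⟨h.card_le, h.useful, fun b hb => ⟨(h.target b hb).1.trans i.lt_succ_self, (h.target b hb).2⟩,
    h.indep, h.dom⟩

/-- If the target `i` is not seen yet, the leftmost guard `a` of `i` is added. By the order claim it
sees whatever any other guard of `i` sees later on. -/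
theorem Greedy.insert {V : ℕ → ℕ → Prop} {C : ℕ → Prop} {N i a : ℕ} {S W : Finset ℕ}
    (h : Greedy V C N i S W)
    (cross : ∀ a a' b d, V a b → V a' b → V a' d → a ≤ a' → b < d → d < N → V a d)
    (hi : i < N) (hC : C i) (hS : ∀ a ∈ S, ¬ V a i) (ha : V a i) (hmin : ∀ a', V a' i → a ≤ a') :
    Greedy V C N (i + 1) (insert a S) (insert i W) := by
  have haS : a ∉ S := fun h => hS a h ha
  have hiW : i ∉ W := fun hw => lt_irrefl _ (h.target i hw).1
  have key : ∀ b ∈ W, ∀ a', V a' b → ¬ V a' i := fun b hb a' h1 h2 => by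
    obtain ⟨a'', h3, h4⟩ := h.dom b hb a' i h1 (h.target b hb).1 hi h2
    exact hS a'' h3 h4
  refine ⟨?_, ?_, ?_, ?_, ?_⟩
  · rw [Finset.card_insert_of_notMem haS, Finset.card_insert_of_notMem hiW]
    exact Nat.succ_le_succ h.card_le
  · intro a' ha'
    rcases Finset.mem_insert.1 ha' with rfl | h'
    · exact ⟨i, hi, ha⟩
    · exact h.useful a' h'
  · intro b hb
    rcases Finset.mem_insert.1 hb with rfl | h'
    · exact ⟨Nat.lt_succ_self _, hC⟩
    · exact h.succ.target b h'
  · intro b hb b' hb' a' h1 h2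
    rcases Finset.mem_insert.1 hb with rfl | h3 <;> rcases Finset.mem_insert.1 hb' with rfl | h4
    · rfl
    · exact absurd h1 (key b' h4 a' h2)
    · exact absurd h2 (key b h3 a' h1)
    · exact h.indep b h3 b' h4 a' h1 h2
  · intro b hb a' d h1 h2 h3 h4
    rcases Finset.mem_insert.1 hb with rfl | h5
    · exact ⟨a, Finset.mem_insert_self _ _, cross a a' b d ha h1 h4 (hmin a' h1) h2 h3⟩
    · obtain ⟨a'', h6, h7⟩ := h.dom b h5 a' d h1 h2 h3 h4
      exact ⟨a'', Finset.mem_insert_of_mem h6, h7⟩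

/-! ### The program -/

/-- The scalar variable stored in cell `0` of array `r`. -/
def var (r : ℕ) : NExp := .load r (.const 0)

/-- Assignment to the scalar variable `r`. -/
def assign (r : ℕ) (e : NExp) : Prog := .setNat r (.const 0) e

/-- The index `i` for `m = false`, and the mirrored index `n - 1 - i` for `m = true`. -/
def ix (m : Bool) (i : NExp) : NExp := if m then .sub (.sub (var 0) (.const 1)) i else i

/-- The ordinate of a vertex of the (possibly mirrored) terrain. -/
def ordinate (m : Bool) (i : NExp) : FExp := .load 1 (ix m i)

/-- The difference of the abscissas of two vertices of the (possibly mirrored) terrain. -/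
def deltaX (m : Bool) (i j : NExp) : FExp :=
  if m then .sub (.load 0 (ix m j)) (.load 0 (ix m i))
  else .sub (.load 0 (ix m i)) (.load 0 (ix m j))

/-- Is the vertex held in variable 5 strictly below the line through the vertices held in
variables 4 and 3? -/
def belowTest (m : Bool) : BExp :=
  .fldLt (.mul (.sub (ordinate m (var 5)) (ordinate m (var 3))) (deltaX m (var 3) (var 4)))
    (.mul (.sub (ordinate m (var 4)) (ordinate m (var 3))) (deltaX m (var 3) (var 5)))

/-- Sets variable 9 to a positive value if and only if the vertex held in variable 4 is reflex and
overlooks the vertex held in variable 3. -/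
def overlookProg (m : Bool) : Prog :=
  .seq (.ite (.and (.fldLt (ordinate m (.add (var 4) (.const 1))) (ordinate m (var 4)))
      (.fldLt (ordinate m (var 3)) (ordinate m (var 4)))) (assign 9 (.const 1))
      (assign 9 (.const 0)))
  (.seq (assign 5 (.add (var 4) (.const 1)))
  (.loop (.natLt (var 5) (var 3))
    (.seq (.ite (belowTest m) .skip (assign 9 (.const 0)))
      (assign 5 (.add (var 5) (.const 1))))))

/-- Scans the guards of the vertex held in variable 3. Afterwards variable 6 tells whether there is
a guard, variable 7 holds the first one, and variable 8 tells whether one has been chosen. -/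
def scanProg (m : Bool) : Prog :=
  .seq (assign 6 (.const 0)) (.seq (assign 8 (.const 0)) (.seq (assign 4 (.const 0))
  (.loop (.natLt (var 4) (var 3))
    (.seq (overlookProg m)
    (.seq (.ite (.natLt (.const 0) (var 9))
      (.seq (.ite (.natLt (var 6) (.const 1)) (.seq (assign 6 (.const 1)) (assign 7 (var 4))) .skip)
        (.ite (.natLt (.const 0) (.load 2 (ix m (var 4)))) (assign 8 (.const 1)) .skip))
      .skip)
    (assign 4 (.add (var 4) (.const 2))))))))

/-- One step of the greedy method, for the vertex held in variable 3. -/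
def stepProg (m : Bool) : Prog :=
  .seq (.ite (.fldLt (ordinate m (var 3)) (ordinate m (.add (var 3) (.const 1))))
    (.seq (scanProg m)
      (.ite (.natLt (var 6) (.const 1)) (assign 1 (.const 0))
        (.ite (.natLt (var 8) (.const 1)) (.setNat 2 (ix m (var 7)) (.const 1)) .skip)))
    .skip)
  (assign 3 (.add (var 3) (.const 2)))

/-- The greedy method on the vertices of even index of the (possibly mirrored) terrain. -/
def sideProg (m : Bool) : Prog :=
  .seq (assign 3 (.const 0)) (.loop (.natLt (var 3) (var 0)) (stepProg m))

/-- The algorithm: the greedy method for the terrain and for its mirror image. -/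
def guardProg : Prog := .seq (assign 1 (.const 1)) (.seq (sideProg false) (sideProg true))

/-! ### Runs with a time bound and a postcondition -/

/-- The values of the variables: the answer (array 1), the output array (array 2) and the scalar
variables 3 to 9: the target `c`, the guard `g` and the vertex `k` in between that are being
inspected, whether a guard of `c` has been found (`f`) and the first one (`b`), whether `c` is seen
by a chosen guard (`cov`), and whether `g` overlooks `c` (`vis`). -/
structure St where
  ans : ℕ
  out : ℕ → ℕ
  c : ℕ
  g : ℕ
  k : ℕ
  f : ℕ
  b : ℕ
  cov : ℕ
  vis : ℕ

section Runs

variable {K : Type} {n : ℕ} {fld : ℕ → ℕ → K}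

/-- The memory that holds the number `n`, the coordinates `fld` and the given variables. -/
def St.mem (n : ℕ) (fld : ℕ → ℕ → K) (s : St) : Memory K where
  nat
    | 0, 0 => n
    | 1, 0 => s.ans
    | 2, a => s.out a
    | 3, 0 => s.c
    | 4, 0 => s.g
    | 5, 0 => s.k
    | 6, 0 => s.f
    | 7, 0 => s.b
    | 8, 0 => s.cov
    | 9, 0 => s.vis
    | _, _ => 0
  fld := fld

theorem updNat_eq {s s' : St} {A a z : ℕ} (h : ∀ B b, (s'.mem n fld).nat B b =
    if B = A ∧ b = a then z else (s.mem n fld).nat B b) :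
    (s.mem n fld).updNat A a z = s'.mem n fld := by
  unfold Memory.updNat
  congr 1
  funext B b
  refine Eq.trans ?_ (h B b).symm
  by_cases hB : B = A
  · subst hB
    simp [Function.update_apply]
  · simp [hB]

theorem upd_ans (s : St) (z : ℕ) :
    (s.mem n fld).updNat 1 0 z = { s with ans := z }.mem n fld :=
  updNat_eq fun B b => by
    simp only [St.mem]
    split <;> simp_all

theorem upd_c (s : St) (z : ℕ) :
    (s.mem n fld).updNat 3 0 z = { s with c := z }.mem n fld :=
  updNat_eq fun B b => by
    simp only [St.mem]
    split <;> simp_all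

theorem upd_g (s : St) (z : ℕ) :
    (s.mem n fld).updNat 4 0 z = { s with g := z }.mem n fld :=
  updNat_eq fun B b => by
    simp only [St.mem]
    split <;> simp_all

theorem upd_k (s : St) (z : ℕ) :
    (s.mem n fld).updNat 5 0 z = { s with k := z }.mem n fld :=
  updNat_eq fun B b => by
    simp only [St.mem]
    split <;> simp_all

theorem upd_f (s : St) (z : ℕ) :
    (s.mem n fld).updNat 6 0 z = { s with f := z }.mem n fld :=
  updNat_eq fun B b => by
    simp only [St.mem]
    split <;> simp_all

theorem upd_b (s : St) (z : ℕ) :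
    (s.mem n fld).updNat 7 0 z = { s with b := z }.mem n fld :=
  updNat_eq fun B b => by
    simp only [St.mem]
    split <;> simp_all

theorem upd_cov (s : St) (z : ℕ) :
    (s.mem n fld).updNat 8 0 z = { s with cov := z }.mem n fld :=
  updNat_eq fun B b => by
    simp only [St.mem]
    split <;> simp_all

theorem upd_vis (s : St) (z : ℕ) :
    (s.mem n fld).updNat 9 0 z = { s with vis := z }.mem n fld :=
  updNat_eq fun B b => by
    simp only [St.mem]
    split <;> simp_all

theorem upd_out (s : St) (a z : ℕ) :
    (s.mem n fld).updNat 2 a z = { s with out := Function.update s.out a z }.mem n fld :=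
  updNat_eq fun B b => by
    simp only [St.mem]
    split <;> simp_all [Function.update_apply]

variable [Field K] [LinearOrder K] {w : K → ℕ}

/-- Started in state `s`, the program halts after a cost of at most `D` in a state satisfying `Q`.
-/
def Runs (w : K → ℕ) (n : ℕ) (fld : ℕ → ℕ → K) (P : Prog) (s : St) (D : ℕ) (Q : St → Prop) : Prop :=
  ∃ s' c, Exec w P (s.mem n fld) (s'.mem n fld) c ∧ c ≤ D ∧ Q s'

theorem Runs.mono {P : Prog} {s : St} {D D' : ℕ} {Q Q' : St → Prop} (h : Runs w n fld P s D Q)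
    (hD : D ≤ D') (hQ : ∀ s', Q s' → Q' s') : Runs w n fld P s D' Q' := by
  obtain ⟨s', c, h1, h2, h3⟩ := h
  exact ⟨s', c, h1, h2.trans hD, hQ _ h3⟩

theorem Runs.skip {s : St} {Q : St → Prop} (h : Q s) : Runs w n fld .skip s 1 Q :=
  ⟨s, 1, .skip _, le_rfl, h⟩

theorem Runs.seq {P P' : Prog} {s : St} {D D' : ℕ} {Q Q' : St → Prop}
    (h : Runs w n fld P s D Q) (h' : ∀ s', Q s' → Runs w n fld P' s' D' Q') :
    Runs w n fld (.seq P P') s (D + D') Q' := by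
  obtain ⟨s1, c, h1, h2, h3⟩ := h
  obtain ⟨s2, c', h4, h5, h6⟩ := h' s1 h3
  exact ⟨s2, c + c', .seq h1 h4, by omega, h6⟩

theorem Runs.ite {b : BExp} {P P' : Prog} {s : St} {C D : ℕ} {Q : St → Prop}
    (hb : b.cost w (s.mem n fld) ≤ C) (h : b.Holds (s.mem n fld) → Runs w n fld P s D Q)
    (h' : ¬ b.Holds (s.mem n fld) → Runs w n fld P' s D Q) :
    Runs w n fld (.ite b P P') s (C + D + 1) Q := by
  by_cases hh : b.Holds (s.mem n fld)
  · obtain ⟨s', c, h1, h2, h3⟩ := h hh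
    exact ⟨s', _, .iteTrue hh h1, by omega, h3⟩
  · obtain ⟨s', c, h1, h2, h3⟩ := h' hh
    exact ⟨s', _, .iteFalse hh h1, by omega, h3⟩

/-- The cost of a loop with at most `N` iterations, where the test costs `C` and the body `D`. -/
def loopCost {R : Type*} [CommSemiring R] (N C D : R) : R := N * (C + D + 1) + C + 1

/-- A loop with `N ≤ M` iterations and an invariant `I` that depends on the number of iterations. -/
theorem Runs.loop {b : BExp} {P : Prog} {C D N M : ℕ} (I : ℕ → St → Prop) (hNM : N ≤ M)
    (hC : ∀ i s, i ≤ N → I i s → b.cost w (s.mem n fld) ≤ C ∧ (b.Holds (s.mem n fld) ↔ i < N))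
    (hP : ∀ i s, i < N → I i s → Runs w n fld P s D (I (i + 1))) {s : St} (h0 : I 0 s) :
    Runs w n fld (.loop b P) s (loopCost M C D) (I N) := by
  have main : ∀ j i s, i + j = N → I i s →
      Runs w n fld (.loop b P) s (loopCost j C D) (I N) := by
    intro j
    induction j with
    | zero =>
      intro i s hi h
      obtain rfl : i = N := by omega
      obtain ⟨h1, h2⟩ := hC i s le_rfl h
      exact ⟨s, _, .loopDone (by simp [h2]), by unfold loopCost; omega, h⟩
    | succ j ih =>
      intro i s hi h
      obtain ⟨h1, h2⟩ := hC i s (by omega) h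
      obtain ⟨s1, c, h3, h4, h5⟩ := hP i s (by omega) h
      obtain ⟨s2, c', h6, h7, h8⟩ := ih (i + 1) s1 (by omega) h5
      refine ⟨s2, _, .loopStep (h2.2 (by omega)) h3 h6, ?_, h8⟩
      unfold loopCost at h7 ⊢
      rw [add_mul]
      omega
  refine (main N 0 s (zero_add _) h0).mono ?_ fun _ h => h
  unfold loopCost
  gcongr

theorem Runs.setNat {A z : ℕ} {a e : NExp} {s s' : St} {D : ℕ} {Q : St → Prop}
    (hz : e.eval (s.mem n fld) = z)
    (h : (s.mem n fld).updNat A (a.eval (s.mem n fld)) z = s'.mem n fld)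
    (hD : a.cost (s.mem n fld) + e.cost (s.mem n fld) + 1 ≤ D) (hQ : Q s') :
    Runs w n fld (.setNat A a e) s D Q :=
  ⟨s', _, by rw [← h, ← hz]; exact .setNat A a e _, hD, hQ⟩

theorem size_le_self (k : ℕ) : Nat.size k ≤ k := Nat.size_le.2 Nat.lt_two_pow_self

end Runs

/-! ### Verification of the program: values and costs of the tests -/

section Verification

variable {K : Type} {n : ℕ} {fld : ℕ → ℕ → K}

/-- The index addressed by `ix m`. -/
def mirrorIdx (m : Bool) (n i : ℕ) : ℕ := if m then n - 1 - i else i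

theorem mirrorIdx_lt {m : Bool} {i : ℕ} (h : i < n) : mirrorIdx m n i < n := by
  unfold mirrorIdx
  split <;> omega

theorem mirrorIdx_inj {m : Bool} {i j : ℕ} (hi : i < n) (hj : j < n) :
    mirrorIdx m n i = mirrorIdx m n j ↔ i = j := by
  unfold mirrorIdx
  split <;> omega

theorem eval_ix (m : Bool) (e : NExp) (s : St) :
    (ix m e).eval (s.mem n fld) = mirrorIdx m n (e.eval (s.mem n fld)) := by
  cases m <;> rfl

theorem cost_var_le {r : ℕ} {s : St} (h : (var r).eval (s.mem n fld) ≤ n) :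
    (var r).cost (s.mem n fld) ≤ n + 2 := by
  have := size_le_self ((var r).eval (s.mem n fld))
  simp only [var] at h this ⊢
  simp only [NExp.cost, Nat.size_zero]
  omega

theorem cost_const_le (k : ℕ) (s : St) : (NExp.const k).cost (s.mem n fld) ≤ k + 1 := by
  have := size_le_self k
  simp only [NExp.cost]
  omega

theorem cost_add_le {a b : NExp} {s : St} {C D L : ℕ} (ha : a.cost (s.mem n fld) ≤ C)
    (hb : b.cost (s.mem n fld) ≤ D) (h : a.eval (s.mem n fld) + b.eval (s.mem n fld) ≤ L) :
    (NExp.add a b).cost (s.mem n fld) ≤ C + D + 1 + L := by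
  have := size_le_self ((NExp.add a b).eval (s.mem n fld))
  simp only [NExp.eval] at this
  simp only [NExp.cost, NExp.eval]
  omega

theorem cost_ix_le {m : Bool} {e : NExp} {s : St} {C : ℕ} (hc : e.cost (s.mem n fld) ≤ C) :
    (ix m e).cost (s.mem n fld) ≤ C + 3 * n + 10 := by
  cases m
  · simp only [ix, Bool.false_eq_true, if_false]
    omega
  · have h1 : (var 0).eval (s.mem n fld) = n := rfl
    have h2 := cost_var_le (r := 0) (s := s) h1.le
    have h3 := size_le_self (n - 1)
    have h4 := size_le_self (n - 1 - e.eval (s.mem n fld))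
    simp only [ix, if_true, NExp.cost, NExp.eval, h1, Nat.size_one]
    omega

theorem cost_var_succ_le {r k : ℕ} {s : St} (h : (var r).eval (s.mem n fld) + k ≤ n) (hk : k ≤ 2) :
    (NExp.add (var r) (.const k)).cost (s.mem n fld) ≤ 2 * n + 6 := by
  have h1 := cost_add_le (L := n) (cost_var_le (r := r) (s := s) (n := n) (fld := fld) (by omega))
    (cost_const_le k s) h
  omega

variable [Field K] {w : K → ℕ} {B : ℕ}

/-- The abscissas of the (possibly mirrored) terrain. -/
def virtX (m : Bool) (n : ℕ) (fld : ℕ → ℕ → K) (i : ℕ) : K :=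
  if m then -fld 0 (n - 1 - i) else fld 0 i

/-- The ordinates of the (possibly mirrored) terrain. -/
def virtY (m : Bool) (n : ℕ) (fld : ℕ → ℕ → K) (i : ℕ) : K := fld 1 (mirrorIdx m n i)

/-- `B` bounds the sizes of all the field numbers that occur in a run. -/
structure Sized (w : K → ℕ) (n : ℕ) (fld : ℕ → ℕ → K) (B : ℕ) : Prop where
  load : ∀ A i, A < 2 → i < n → w (fld A i) ≤ B
  sub : ∀ A i j, A < 2 → i < n → j < n → w (fld A i - fld A j) ≤ B
  mul : ∀ i j k l, i < n → j < n → k < n → l < n →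
    w ((fld 1 i - fld 1 j) * (fld 0 k - fld 0 l)) ≤ B

theorem eval_ordinate (m : Bool) (e : NExp) (s : St) :
    (ordinate m e).eval (s.mem n fld) = virtY m n fld (e.eval (s.mem n fld)) := by
  simp only [ordinate, FExp.eval, eval_ix]
  rfl

theorem eval_deltaX (m : Bool) (a b : NExp) (s : St) : (deltaX m a b).eval (s.mem n fld) =
    virtX m n fld (a.eval (s.mem n fld)) - virtX m n fld (b.eval (s.mem n fld)) := by
  have h : ∀ i, (s.mem n fld).fld 0 i = fld 0 i := fun _ => rfl
  cases m
  · simp [deltaX, FExp.eval, eval_ix, h, virtX, mirrorIdx]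
  · simp only [deltaX, FExp.eval, eval_ix, h, virtX, mirrorIdx, if_true]
    ring

theorem Sized.sub_mul_sub (hB : Sized w n fld B) {m : Bool} {i j k l : ℕ} (hi : i < n) (hj : j < n)
    (hk : k < n) (hl : l < n) : w ((virtY m n fld i - virtY m n fld j) *
      (virtX m n fld k - virtX m n fld l)) ≤ B := by
  cases m
  · exact hB.mul _ _ _ _ hi hj hk hl
  · have := hB.mul (n - 1 - i) (n - 1 - j) (n - 1 - l) (n - 1 - k) (by omega) (by omega) (by omega)
      (by omega)
    rwa [show virtX true n fld k - virtX true n fld l = fld 0 (n - 1 - l) - fld 0 (n - 1 - k) by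
      simp only [virtX, if_true]; ring]

theorem cost_ordinate_le (hB : Sized w n fld B) {m : Bool} {e : NExp} {s : St} {C : ℕ}
    (hc : e.cost (s.mem n fld) ≤ C) (h : e.eval (s.mem n fld) < n) :
    (ordinate m e).cost w (s.mem n fld) ≤ C + 3 * n + B + 11 := by
  have h1 := cost_ix_le (m := m) hc
  have h2 := hB.load 1 _ one_lt_two (mirrorIdx_lt (m := m) h)
  simp only [ordinate, FExp.cost, FExp.eval, eval_ix]
  change _ + 1 + w (fld 1 _) ≤ _
  omega

theorem cost_deltaX_le (hB : Sized w n fld B) {m : Bool} {a b : NExp} {s : St} {C : ℕ}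
    (ha : a.cost (s.mem n fld) ≤ C) (hb : b.cost (s.mem n fld) ≤ C)
    (ha' : a.eval (s.mem n fld) < n) (hb' : b.eval (s.mem n fld) < n) :
    (deltaX m a b).cost w (s.mem n fld) ≤ 2 * (C + 3 * n + B + 11) + 1 + B := by
  have h1 := cost_ix_le (m := m) ha
  have h2 := cost_ix_le (m := m) hb
  have h3 := hB.load 0 _ two_pos (mirrorIdx_lt (m := m) ha')
  have h4 := hB.load 0 _ two_pos (mirrorIdx_lt (m := m) hb')
  have h5 := hB.sub 0 _ _ two_pos (mirrorIdx_lt (m := m) ha') (mirrorIdx_lt (m := m) hb')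
  have h6 := hB.sub 0 _ _ two_pos (mirrorIdx_lt (m := m) hb') (mirrorIdx_lt (m := m) ha')
  cases m
  · simp only [deltaX, Bool.false_eq_true, if_false, FExp.cost, FExp.eval, eval_ix]
    change _ + 1 + w (fld 0 _) + (_ + 1 + w (fld 0 _)) + 1 + w (fld 0 _ - fld 0 _) ≤ _
    omega
  · simp only [deltaX, if_true, FExp.cost, FExp.eval, eval_ix]
    change _ + 1 + w (fld 0 _) + (_ + 1 + w (fld 0 _)) + 1 + w (fld 0 _ - fld 0 _) ≤ _
    omega

/-- A bound for the cost of every single assignment or test of the program. The most expensive one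
is `belowTest`, with eight accesses to coordinates and six field operations. -/
def unitCost {R : Type*} [CommSemiring R] (n B : R) : R := 150 * (n + B + 1)

theorem cost_fldLt_le (hB : Sized w n fld B) {m : Bool} {a b : NExp} {s : St}
    (ha : a.cost (s.mem n fld) ≤ 2 * n + 5) (hb : b.cost (s.mem n fld) ≤ 2 * n + 5)
    (ha' : a.eval (s.mem n fld) < n) (hb' : b.eval (s.mem n fld) < n) :
    (BExp.fldLt (ordinate m a) (ordinate m b)).cost w (s.mem n fld) ≤ 60 * (n + B + 1) := by
  have h1 := cost_ordinate_le hB (m := m) ha ha'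
  have h2 := cost_ordinate_le hB (m := m) hb hb'
  simp only [BExp.cost]
  omega

theorem cost_belowTest_le (hB : Sized w n fld B) (m : Bool) {s : St} (hg : s.g < n) (hc : s.c < n)
    (hk : s.k < n) : (belowTest m).cost w (s.mem n fld) ≤ unitCost n B := by
  have vg : (var 4).eval (s.mem n fld) < n := hg
  have vc : (var 3).eval (s.mem n fld) < n := hc
  have vk : (var 5).eval (s.mem n fld) < n := hk
  have cg := cost_var_le vg.le
  have cc := cost_var_le vc.le
  have ck := cost_var_le vk.le
  have og := cost_ordinate_le hB (m := m) cg vg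
  have oc := cost_ordinate_le hB (m := m) cc vc
  have ok := cost_ordinate_le hB (m := m) ck vk
  have d1 := cost_deltaX_le hB (m := m) cc cg vc vg
  have d2 := cost_deltaX_le hB (m := m) cc ck vc vk
  have s1 := hB.sub 1 _ _ one_lt_two (mirrorIdx_lt (m := m) vk) (mirrorIdx_lt (m := m) vc)
  have s2 := hB.sub 1 _ _ one_lt_two (mirrorIdx_lt (m := m) vg) (mirrorIdx_lt (m := m) vc)
  have m1 := hB.sub_mul_sub (m := m) vk vc vc vg
  have m2 := hB.sub_mul_sub (m := m) vg vc vc vk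
  simp only [belowTest, BExp.cost, FExp.cost, FExp.eval, eval_ordinate, eval_deltaX]
  simp only [virtY] at m1 m2 ⊢
  unfold unitCost
  omega

theorem cost_natLt_le {a b : NExp} {s : St} (ha : a.cost (s.mem n fld) ≤ 2 * n + 5)
    (hb : b.cost (s.mem n fld) ≤ 2 * n + 5) :
    (BExp.natLt a b).cost w (s.mem n fld) ≤ unitCost n B := by
  simp only [BExp.cost]
  unfold unitCost
  omega

variable [LinearOrder K]

theorem holds_belowTest (m : Bool) (s : St) : (belowTest m).Holds (s.mem n fld) ↔
    Below (virtX m n fld) (virtY m n fld) s.g s.c s.k := by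
  simp only [belowTest, BExp.Holds, FExp.eval, eval_ordinate, eval_deltaX]
  rfl

/-! ### Verification of the program: the loops -/

theorem Runs.assign {r z : ℕ} {e : NExp} {s s' : St} {Q : St → Prop}
    (hz : e.eval (s.mem n fld) = z) (h : (s.mem n fld).updNat r 0 z = s'.mem n fld)
    (hD : e.cost (s.mem n fld) ≤ 2 * n + 6) (hQ : Q s') :
    Runs w n fld (assign r e) s (unitCost n B) Q := by
  refine Runs.setNat (z := z) hz h ?_ hQ
  have := cost_const_le (n := n) (fld := fld) 0 s
  unfold unitCost
  omega

/-- The cost bound of `overlookProg`, where `D` is the cost of a single step. -/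
def overlookCost {R : Type*} [CommSemiring R] (n D : R) : R := loopCost n D (4 * D) + 4 * D

theorem runs_overlookProg (hB : Sized w n fld B) (m : Bool) {s : St} (hgc : s.g < s.c)
    (hc : s.c < n) : Runs w n fld (overlookProg m) s (overlookCost n (unitCost n B)) fun s' =>
      ∃ k v, s' = { s with k := k, vis := v } ∧ v ≤ 1 ∧ (0 < v ↔
        virtY m n fld (s.g + 1) < virtY m n fld s.g ∧
          Overlooks (virtX m n fld) (virtY m n fld) s.g s.c) := by
  have hD : 150 ≤ unitCost n B := by unfold unitCost; omega
  have hgn : s.g < n := hgc.trans hc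
  have vg : (var 4).eval (s.mem n fld) = s.g := rfl
  have vc : (var 3).eval (s.mem n fld) = s.c := rfl
  have cg := cost_var_le (vg.trans_le hgn.le)
  have cc := cost_var_le (vc.trans_le hc.le)
  have csg := cost_add_le (L := n) cg (cost_const_le 1 s) (by rw [vg]; simp only [NExp.eval]; omega)
  refine Runs.mono (D := (unitCost n B + unitCost n B + 1) + (unitCost n B +
    loopCost n (unitCost n B) ((unitCost n B + unitCost n B + 1) + unitCost n B))) ?_ ?_
    fun _ h => h
  rotate_left
  · have : loopCost n (unitCost n B) ((unitCost n B + unitCost n B + 1) + unitCost n B) ≤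
        loopCost n (unitCost n B) (4 * unitCost n B) := by
      unfold loopCost
      gcongr
      omega
    unfold overlookCost
    omega
  refine Runs.seq (Q := fun s' => ∃ v, s' = { s with vis := v } ∧ v ≤ 1 ∧ (0 < v ↔
      virtY m n fld (s.g + 1) < virtY m n fld s.g ∧ virtY m n fld s.c < virtY m n fld s.g))
    (Runs.ite ?_ (fun h => ?_) (fun h => ?_)) ?_
  · have h1 := cost_fldLt_le hB (m := m) (a := .add (var 4) (.const 1)) (b := var 4) (s := s)
      (by omega) (by omega) (show s.g + 1 < n by omega) hgn
    have h2 := cost_fldLt_le hB (m := m) (a := var 3) (b := var 4) (s := s)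
      (by omega) (by omega) hc hgn
    simp only [BExp.cost] at h1 h2 ⊢
    unfold unitCost
    omega
  · refine Runs.assign rfl (upd_vis s 1) ((cost_const_le 1 s).trans (by omega)) ⟨1, rfl, le_rfl, ?_⟩
    simp only [BExp.Holds, eval_ordinate] at h
    exact ⟨fun _ => h, fun _ => one_pos⟩
  · refine Runs.assign rfl (upd_vis s 0) ((cost_const_le 0 s).trans (by omega))
      ⟨0, rfl, zero_le_one, ?_⟩
    simp only [BExp.Holds, eval_ordinate] at h
    exact ⟨fun h => absurd h (lt_irrefl _), fun h' => absurd h' h⟩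
  rintro _ ⟨v, rfl, hv1, hv⟩
  refine Runs.seq (Q := fun s' => s' = { s with k := s.g + 1, vis := v }) ?_ ?_
  · exact Runs.assign rfl (upd_k _ _) (cost_var_succ_le (by change s.g + 1 ≤ n; omega) one_le_two)
      rfl
  rintro _ rfl
  refine (Runs.loop (N := s.c - (s.g + 1)) (fun i s' => ∃ v, s' =
      { s with k := s.g + 1 + i, vis := v } ∧ v ≤ 1 ∧ (0 < v ↔
      virtY m n fld (s.g + 1) < virtY m n fld s.g ∧ virtY m n fld s.c < virtY m n fld s.g ∧
        ∀ k, s.g < k → k < s.g + 1 + i → Below (virtX m n fld) (virtY m n fld) s.g s.c k))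
    (by omega) ?_ ?_ ⟨v, rfl, hv1, by rw [hv]; grind⟩).mono le_rfl ?_
  · rintro i _ hi ⟨v, rfl, -⟩
    constructor
    · have h1 := cost_var_le (n := n) (fld := fld) (r := 5)
        (s := { s with k := s.g + 1 + i, vis := v }) (by change s.g + 1 + i ≤ n; omega)
      have h2 := cost_var_le (n := n) (fld := fld) (r := 3)
        (s := { s with k := s.g + 1 + i, vis := v }) hc.le
      simp only [BExp.cost]
      unfold unitCost
      omega
    · change s.g + 1 + i < s.c ↔ _
      omega
  · rintro i _ hi ⟨v, rfl, hv1, hv⟩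
    refine Runs.seq (Q := fun s' => ∃ v, s' =
      { s with k := s.g + 1 + i, vis := v } ∧ v ≤ 1 ∧ (0 < v ↔
      virtY m n fld (s.g + 1) < virtY m n fld s.g ∧ virtY m n fld s.c < virtY m n fld s.g ∧
        ∀ k, s.g < k → k < s.g + 1 + (i + 1) →
          Below (virtX m n fld) (virtY m n fld) s.g s.c k)) (Runs.ite ?_ ?_ ?_) ?_
    · exact cost_belowTest_le hB m hgn hc (by change s.g + 1 + i < n; omega)
    · intro h
      rw [holds_belowTest] at h
      refine (Runs.skip ⟨v, rfl, hv1, ?_⟩).mono (by omega) fun _ h => h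
      rw [hv]
      refine and_congr_right fun _ => and_congr_right fun _ =>
        ⟨fun h' k h1 h2 => ?_, fun h' k h1 h2 => h' k h1 (by omega)⟩
      rcases (show k ≤ s.g + 1 + i by omega).lt_or_eq with h3 | rfl
      · exact h' k h1 h3
      · exact h
    · intro h
      rw [holds_belowTest] at h
      refine Runs.assign rfl (upd_vis _ 0) ((cost_const_le 0 _).trans (by omega))
        ⟨0, rfl, zero_le_one, ?_⟩
      exact ⟨fun h' => absurd h' (lt_irrefl _),
        fun h' => absurd (h'.2.2 (s.g + 1 + i) (by omega) (by omega)) h⟩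
    rintro _ ⟨v, rfl, hv1, hv⟩
    exact Runs.assign rfl (upd_k _ _)
      (cost_var_succ_le (by change s.g + 1 + i + 1 ≤ n; omega) one_le_two) ⟨v, rfl, hv1, hv⟩
  · rintro _ ⟨v, rfl, hv1, hv⟩
    refine ⟨_, v, rfl, hv1, ?_⟩
    rw [hv, show s.g + 1 + (s.c - (s.g + 1)) = s.c by omega, Overlooks]

/-- The relation `Guards` for the (possibly mirrored) terrain given by `fld`. -/
def VirtGuards (m : Bool) (n : ℕ) (fld : ℕ → ℕ → K) (a b : ℕ) : Prop :=
  Guards (virtX m n fld) (virtY m n fld) a b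

/-- The vertex `2 b` of the (possibly mirrored) terrain given by `fld` is convex. -/
def VirtConvex (m : Bool) (n : ℕ) (fld : ℕ → ℕ → K) (b : ℕ) : Prop :=
  virtY m n fld (2 * b) < virtY m n fld (2 * b + 1)

/-- The result of scanning the guards `a < i` of the target `j`. -/
structure Scanned (m : Bool) (n : ℕ) (fld : ℕ → ℕ → K) (s : St) (j i : ℕ) (s' : St) : Prop where
  f_le : s'.f ≤ 1
  cov_le : s'.cov ≤ 1
  ans : s'.ans = s.ans
  out : s'.out = s.out
  c : s'.c = s.c
  g : s'.g = 2 * i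
  found : 0 < s'.f ↔ ∃ a < i, VirtGuards m n fld a j
  best : 0 < s'.f → ∃ a, s'.b = 2 * a ∧ VirtGuards m n fld a j ∧
    ∀ a', VirtGuards m n fld a' j → a ≤ a'
  covered : 0 < s'.cov ↔ ∃ a < i, VirtGuards m n fld a j ∧ 0 < s.out (mirrorIdx m n (2 * a))

/-- The cost bound of `scanProg`. -/
def scanCost {R : Type*} [CommSemiring R] (n D : R) : R :=
  loopCost n D (overlookCost n D + 12 * D) + 3 * D

theorem runs_scanProg (hB : Sized w n fld B) (m : Bool) {s : St} {j : ℕ} (hj : s.c = 2 * j)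
    (hc : s.c < n) (hout : ∀ p, s.out p ≤ 1) :
    Runs w n fld (scanProg m) s (scanCost n (unitCost n B)) (Scanned m n fld s j j) := by
  have hD : 150 ≤ unitCost n B := by unfold unitCost; omega
  have c0 := fun s => cost_const_le (n := n) (fld := fld) 0 s
  have c1 := fun s => cost_const_le (n := n) (fld := fld) 1 s
  refine Runs.mono (D := unitCost n B + (unitCost n B + (unitCost n B +
    loopCost n (unitCost n B) (overlookCost n (unitCost n B) + 12 * unitCost n B)))) ?_
    (by unfold scanCost; omega) fun _ h => h
  refine Runs.seq (Q := fun s' => s' = { s with f := 0 })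
    (Runs.assign rfl (upd_f s 0) ((c0 s).trans (by omega)) rfl) ?_
  rintro _ rfl
  refine Runs.seq (Q := fun s' => s' = { s with f := 0, cov := 0 })
    (Runs.assign rfl (upd_cov _ 0) ((c0 _).trans (by omega)) rfl) ?_
  rintro _ rfl
  refine Runs.seq (Q := fun s' => s' = { s with f := 0, cov := 0, g := 0 })
    (Runs.assign rfl (upd_g _ 0) ((c0 _).trans (by omega)) rfl) ?_
  rintro _ rfl
  refine Runs.loop (N := j) (Scanned m n fld s j) (by omega : j ≤ n) ?_ ?_
    ⟨zero_le_one, zero_le_one, rfl, rfl, rfl, rfl, ?_, fun h => absurd h (lt_irrefl _), ?_⟩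
  · intro i s' hi h
    have hg := h.g
    have hc' := h.c
    constructor
    · exact cost_natLt_le ((cost_var_le (by change s'.g ≤ n; omega)).trans (by omega))
        ((cost_var_le (by change s'.c ≤ n; omega)).trans (by omega))
    · change s'.g < s'.c ↔ _
      omega
  · intro i s' hi h
    have hg := h.g
    have hc' := h.c
    have hout' := h.out
    have hf := h.f_le
    refine Runs.mono (D := overlookCost n (unitCost n B) + ((unitCost n B +
      ((unitCost n B + (unitCost n B + unitCost n B) + 1) +
      (unitCost n B + unitCost n B + 1)) + 1) + unitCost n B)) ?_ (by omega) fun _ h => h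
    refine Runs.seq (runs_overlookProg hB m (by omega) (by omega)) ?_
    rintro _ ⟨k, v, rfl, hv1, hv⟩
    have hv : 0 < v ↔ VirtGuards m n fld i j := by
      rw [hv, hg, hc', hj, VirtGuards, Guards]
      simp [hi]
    refine Runs.seq (Q := fun s'' => Scanned m n fld s j (i + 1) { s'' with g := 2 * (i + 1) } ∧
      s''.g = 2 * i) ?_ ?_
    · refine Runs.ite (cost_natLt_le ((c0 _).trans (by omega))
        ((cost_var_le (by change v ≤ n; omega)).trans (by omega))) (fun hvis => ?_) (fun hvis => ?_)
      · replace hvis : VirtGuards m n fld i j := hv.1 hvis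
        refine Runs.seq (Q := fun s'' => ∃ f b, s'' = { s' with k := k, vis := v, f := f, b := b } ∧
          f = 1 ∧ ∃ a, b = 2 * a ∧ VirtGuards m n fld a j ∧
            ∀ a', VirtGuards m n fld a' j → a ≤ a') (Runs.ite (cost_natLt_le
          ((cost_var_le (by change s'.f ≤ n; omega)).trans (by omega)) ((c1 _).trans (by omega)))
          (fun h0 => ?_) (fun h0 => ?_)) ?_
        · replace h0 : s'.f < 1 := h0
          refine Runs.seq (Q := fun s'' => s'' = { s' with k := k, vis := v, f := 1 })
            (Runs.assign rfl (upd_f _ 1) ((c1 _).trans (by omega)) rfl) ?_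
          rintro _ rfl
          refine Runs.assign rfl (upd_b _ _) ((cost_var_le (by change s'.g ≤ n; omega)).trans
            (by omega)) ⟨1, s'.g, rfl, rfl, i, hg, hvis, fun a' ha' => ?_⟩
          by_contra hlt
          have := h.found.2 ⟨a', not_le.1 hlt, ha'⟩
          omega
        · replace h0 : ¬ s'.f < 1 := h0
          exact (Runs.skip ⟨s'.f, s'.b, rfl, by omega, h.best (by omega)⟩).mono (by omega)
            fun _ h => h
        · rintro _ ⟨f, b, rfl, rfl, hb⟩
          have hp : s'.out (mirrorIdx m n s'.g) ≤ 1 := by rw [hout']; exact hout _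
          have hcost : (NExp.load 2 (ix m (var 4))).cost
              (St.mem n fld { s' with k := k, vis := v, f := 1, b := b }) ≤ 4 * n + 14 := by
            have h1 := cost_ix_le (m := m) (cost_var_le (n := n) (fld := fld) (r := 4)
              (s := { s' with k := k, vis := v, f := 1, b := b }) (by change s'.g ≤ n; omega))
            have h2 := size_le_self (s'.out (mirrorIdx m n s'.g))
            simp only [NExp.cost, NExp.eval, eval_ix]
            change _ + 1 + Nat.size (s'.out (mirrorIdx m n s'.g)) ≤ _
            omega
          -- `x` is the new value of the variable `cov`
          have hcov : ∀ x ≤ 1, (0 < x ↔ 0 < s'.cov ∨ 0 < s.out (mirrorIdx m n (2 * i))) →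
              Scanned m n fld s j (i + 1) { s' with
                k := k, vis := v, f := 1, b := b, cov := x, g := 2 * (i + 1) } := fun x hx hx' => by
            refine ⟨le_rfl, hx, h.ans, h.out, h.c, rfl, ?_, fun _ => hb, ?_⟩
            · exact ⟨fun _ => ⟨i, Nat.lt_succ_self i, hvis⟩, fun _ => one_pos⟩
            · change 0 < x ↔ _
              rw [hx', h.covered]
              constructor
              · rintro (⟨a, ha, ha'⟩ | h0)
                · exact ⟨a, ha.trans (Nat.lt_succ_self i), ha'⟩
                · exact ⟨i, Nat.lt_succ_self i, hvis, h0⟩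
              · rintro ⟨a, ha, ha'⟩
                rcases (Nat.lt_succ_iff.1 ha).lt_or_eq with h0 | rfl
                · exact Or.inl ⟨a, h0, ha'⟩
                · exact Or.inr ha'.2
          refine Runs.ite ?_ (fun h0 => ?_) (fun h0 => ?_)
          · have := c0 { s' with k := k, vis := v, f := 1, b := b }
            simp only [BExp.cost]
            unfold unitCost
            omega
          all_goals simp only [BExp.Holds, NExp.eval, eval_ix] at h0
          · change 0 < s'.out (mirrorIdx m n s'.g) at h0
            rw [hout', hg] at h0
            exact Runs.assign rfl (upd_cov _ 1) ((c1 _).trans (by omega))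
              ⟨hcov 1 le_rfl ⟨fun _ => Or.inr h0, fun _ => one_pos⟩, hg⟩
          · change ¬ 0 < s'.out (mirrorIdx m n s'.g) at h0
            rw [hout', hg] at h0
            exact (Runs.skip ⟨hcov s'.cov h.cov_le (by simp [h0]), hg⟩).mono (by omega) fun _ h => h
      · replace hvis : ¬ VirtGuards m n fld i j := fun h' => hvis (hv.2 h')
        refine (Runs.skip ⟨⟨h.f_le, h.cov_le, h.ans, h.out, h.c, rfl, ?_, h.best, ?_⟩, hg⟩).mono
          (by omega) fun _ h => h
        · refine h.found.trans ⟨fun ⟨a, ha, h1⟩ => ⟨a, ha.trans (Nat.lt_succ_self i), h1⟩,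
            fun ⟨a, ha, h1⟩ => ?_⟩
          rcases (Nat.lt_succ_iff.1 ha).lt_or_eq with h0 | rfl
          · exact ⟨a, h0, h1⟩
          · exact absurd h1 hvis
        · refine h.covered.trans ⟨fun ⟨a, ha, h1⟩ => ⟨a, ha.trans (Nat.lt_succ_self i), h1⟩,
            fun ⟨a, ha, h1⟩ => ?_⟩
          rcases (Nat.lt_succ_iff.1 ha).lt_or_eq with h0 | rfl
          · exact ⟨a, h0, h1⟩
          · exact absurd h1.1 hvis
    · rintro s'' ⟨h1, h3⟩
      refine Runs.assign ?_ (upd_g s'' _) (cost_var_succ_le ?_ le_rfl) h1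
      · change s''.g + 2 = _
        omega
      · change s''.g + 2 ≤ n
        omega
  · simp
  · simp

/-- The invariant of `sideProg`: the targets below `i` have been processed; the set of chosen guards
is added to an output `out₀`, and the answer `ans₀` is reset if a target without guards is met. -/
structure SideInv (m : Bool) (n : ℕ) (fld : ℕ → ℕ → K) (s₀ : St) (i : ℕ) (S W : Finset ℕ)
    (s : St) : Prop where
  c : s.c = 2 * i
  out : ∀ p, s.out p = if ∃ a ∈ S, p = mirrorIdx m n (2 * a) then 1 else s₀.out p
  greedy : Greedy (VirtGuards m n fld) (VirtConvex m n fld) (n / 2) i S W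
  ans : (s.ans = s₀.ans ∧ ∀ b < i, VirtConvex m n fld b → ∃ a ∈ S, VirtGuards m n fld a b) ∨
    (s.ans = 0 ∧ ∃ b < i, VirtConvex m n fld b ∧ ∀ a, ¬ VirtGuards m n fld a b)

/-- The cost bound of `sideProg`. -/
def sideCost {R : Type*} [CommSemiring R] (n D : R) : R :=
  loopCost n D (scanCost n D + 10 * D) + D

theorem runs_sideProg (hB : Sized w n fld B) (m : Bool) {s₀ : St} (hn : Even n)
    (hout0 : ∀ p, s₀.out p ≤ 1) (hfree : ∀ a, 2 * a < n → s₀.out (mirrorIdx m n (2 * a)) = 0)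
    (cross : ∀ a a' b d, VirtGuards m n fld a b → VirtGuards m n fld a' b →
      VirtGuards m n fld a' d → a ≤ a' → b < d → d < n / 2 → VirtGuards m n fld a d) :
    Runs w n fld (sideProg m) s₀ (sideCost n (unitCost n B))
      fun s => ∃ S W, SideInv m n fld s₀ (n / 2) S W s := by
  have hD : 150 ≤ unitCost n B := by unfold unitCost; omega
  have c0 := fun s => cost_const_le (n := n) (fld := fld) 0 s
  have c1 := fun s => cost_const_le (n := n) (fld := fld) 1 s
  have hn2 : 2 * (n / 2) = n := Nat.two_mul_div_two_of_even hn
  refine Runs.mono (D := unitCost n B + loopCost n (unitCost n B) (scanCost n (unitCost n B) +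
    10 * unitCost n B)) ?_ (by unfold sideCost; omega) fun _ h => h
  refine Runs.seq (Q := fun s' => s' = { s₀ with c := 0 })
    (Runs.assign rfl (upd_c s₀ 0) ((c0 s₀).trans (by omega)) rfl) ?_
  rintro _ rfl
  refine Runs.loop (N := n / 2) (fun i s => ∃ S W, SideInv m n fld s₀ i S W s)
    (by omega : n / 2 ≤ n) ?_ ?_
    ⟨∅, ∅, rfl, by simp, .empty _ _ _, Or.inl ⟨rfl, by simp⟩⟩
  · rintro i s hi ⟨S, W, h⟩
    have hc := h.c
    constructor
    · exact cost_natLt_le ((cost_var_le (by change s.c ≤ n; omega)).trans (by omega))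
        ((cost_var_le (by change n ≤ n; omega)).trans (by omega))
    · change s.c < n ↔ _
      omega
  · rintro i s hi ⟨S, W, h⟩
    have hc := h.c
    have hcn : s.c < n := by omega
    have hout : ∀ p, s.out p ≤ 1 := fun p => by
      rw [h.out]
      split
      · exact le_rfl
      · exact hout0 p
    -- the output array tells which guards have been chosen
    have hmem : ∀ a, VirtGuards m n fld a i → (0 < s.out (mirrorIdx m n (2 * a)) ↔ a ∈ S) := by
      intro a ha
      have han : 2 * a < n := by have := ha.1; omega
      rw [h.out]
      split
      · rename_i h0
        obtain ⟨a', ha', he⟩ := h0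
        obtain ⟨b, hb, hab⟩ := h.greedy.useful a' ha'
        have hab := hab.1
        rw [mirrorIdx_inj han (by omega)] at he
        obtain rfl : a = a' := by omega
        simp [ha']
      · rename_i h0
        rw [hfree a han]
        simp only [lt_irrefl, false_iff]
        exact fun h1 => h0 ⟨a, h1, rfl⟩
    refine Runs.mono (D := (unitCost n B + (scanCost n (unitCost n B) + (unitCost n B +
      (unitCost n B + unitCost n B + 1) + 1)) + 1) + unitCost n B) ?_ (by omega) fun _ h => h
    refine Runs.seq (Q := fun s' => ∃ S W, SideInv m n fld s₀ (i + 1) S W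
      { s' with c := 2 * (i + 1) } ∧ s'.c = 2 * i) (Runs.ite ?_ (fun hconv => ?_)
        (fun hconv => ?_)) ?_
    · have h1 := cost_var_le (n := n) (fld := fld) (r := 3) (s := s) hcn.le
      have h2 := cost_add_le (L := n) h1 (c1 s) (by change s.c + 1 ≤ n; omega)
      refine (cost_fldLt_le hB (a := var 3) (b := .add (var 3) (.const 1)) (s := s) (by omega)
        (by omega) hcn (show s.c + 1 < n by omega)).trans ?_
      unfold unitCost
      omega
    · replace hconv : VirtConvex m n fld i := by
        simp only [BExp.Holds, eval_ordinate] at hconv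
        change virtY m n fld s.c < virtY m n fld (s.c + 1) at hconv
        rwa [hc] at hconv
      refine Runs.seq (runs_scanProg hB m hc hcn hout) fun s' h' => ?_
      have hc' := h'.c
      have hf := h'.f_le
      have hcov := h'.cov_le
      have hlift : (∃ a ∈ S, VirtGuards m n fld a i) → s'.ans = s.ans → s'.out = s.out →
          SideInv m n fld s₀ (i + 1) S W { s' with c := 2 * (i + 1) } := by
        intro hcv h1 h2
        refine ⟨rfl, fun p => (congrFun h2 p).trans (h.out p), h.greedy.succ, ?_⟩
        rcases h.ans with ⟨h3, h4⟩ | ⟨h3, b, hb, h4⟩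
        · refine Or.inl ⟨h1.trans h3, fun b hb hb' => ?_⟩
          rcases (Nat.lt_succ_iff.1 hb).lt_or_eq with h0 | rfl
          · exact h4 b h0 hb'
          · exact hcv
        · exact Or.inr ⟨h1.trans h3, b, by omega, h4⟩
      refine Runs.ite (cost_natLt_le ((cost_var_le (by change s'.f ≤ n; omega)).trans (by omega))
        ((c1 _).trans (by omega))) (fun h0 => ?_) (fun h0 => ?_)
      · -- the target `i` has no guard at all
        replace h0 : s'.f < 1 := h0
        refine (Runs.assign (B := B) rfl (upd_ans _ 0) ((c0 _).trans (by omega)) ?_).mono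
          (by omega) fun _ h => h
        refine ⟨S, W, ⟨rfl, fun p => (congrFun h'.out p).trans (h.out p), h.greedy.succ,
          Or.inr ⟨rfl, i, Nat.lt_succ_self i, hconv, fun a ha => ?_⟩⟩, hc'.trans hc⟩
        have := h'.found.2 ⟨a, ha.1, ha⟩
        omega
      · replace h0 : ¬ s'.f < 1 := h0
        obtain ⟨a, hb, ha, hmin⟩ := h'.best (by omega)
        have hai := ha.1
        refine Runs.ite (cost_natLt_le ((cost_var_le (by change s'.cov ≤ n; omega)).trans
          (by omega)) ((c1 _).trans (by omega))) (fun h1 => ?_) (fun h1 => ?_)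
        · replace h1 : s'.cov < 1 := h1
          have hS : ∀ a ∈ S, ¬ VirtGuards m n fld a i := fun a haS ha => by
            have := h'.covered.2 ⟨a, ha.1, ha, (hmem a ha).2 haS⟩
            omega
          have hidx : (ix m (var 7)).eval (s'.mem n fld) = mirrorIdx m n (2 * a) := by
            rw [eval_ix, ← hb]
            rfl
          refine Runs.setNat (z := 1) (s' := { s' with
            out := Function.update s'.out (mirrorIdx m n (2 * a)) 1 }) rfl ?_ ?_ ?_
          · rw [hidx]
            exact upd_out _ _ _
          · have h2 := cost_ix_le (m := m) (cost_var_le (n := n) (fld := fld) (r := 7) (s := s')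
              (by change s'.b ≤ n; omega))
            have h3 := c1 s'
            unfold unitCost
            omega
          · refine ⟨insert a S, insert i W, ⟨rfl, fun p => ?_,
              h.greedy.insert cross hi hconv hS ha hmin, ?_⟩, hc'.trans hc⟩
            · change Function.update s'.out (mirrorIdx m n (2 * a)) 1 p = _
              by_cases hp : p = mirrorIdx m n (2 * a)
              · simp [hp]
              · rw [Function.update_of_ne hp, h'.out, h.out]
                simp [hp]
            · rcases h.ans with ⟨h3, h4⟩ | ⟨h3, b, hb, h4⟩
              · refine Or.inl ⟨h'.ans.trans h3, fun b hb hb' => ?_⟩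
                rcases (Nat.lt_succ_iff.1 hb).lt_or_eq with h0 | rfl
                · obtain ⟨a', h5, h6⟩ := h4 b h0 hb'
                  exact ⟨a', Finset.mem_insert_of_mem h5, h6⟩
                · exact ⟨a, Finset.mem_insert_self _ _, ha⟩
              · exact Or.inr ⟨h'.ans.trans h3, b, by omega, h4⟩
        · replace h1 : ¬ s'.cov < 1 := h1
          obtain ⟨a', -, h2, h3⟩ := h'.covered.1 (by omega)
          exact (Runs.skip ⟨S, W, hlift ⟨a', (hmem a' h2).1 h3, h2⟩ h'.ans h'.out,
            hc'.trans hc⟩).mono (by omega) fun _ h => h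
    · replace hconv : ¬ VirtConvex m n fld i := by
        simp only [BExp.Holds, eval_ordinate] at hconv
        change ¬ virtY m n fld s.c < virtY m n fld (s.c + 1) at hconv
        rwa [hc] at hconv
      refine (Runs.skip ⟨S, W, ⟨rfl, h.out, h.greedy.succ, ?_⟩, hc⟩).mono (by omega) fun _ h => h
      rcases h.ans with ⟨h3, h4⟩ | ⟨h3, b, hb, h4⟩
      · refine Or.inl ⟨h3, fun b hb hb' => ?_⟩
        rcases (Nat.lt_succ_iff.1 hb).lt_or_eq with h0 | rfl
        · exact h4 b h0 hb'
        · exact absurd hb' hconv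
      · exact Or.inr ⟨h3, b, by omega, h4⟩
    · rintro s' ⟨S, W, h1, h2⟩
      refine Runs.assign ?_ (upd_c s' _) (cost_var_succ_le ?_ le_rfl) ⟨S, W, h1⟩
      · change s'.c + 2 = _
        omega
      · change s'.c + 2 ≤ n
        omega

end Verification

/-! ### Optimality of the chosen guards -/

namespace OrthogonalTerrain

variable {n : ℕ} (T : OrthogonalTerrain n)

/-- The terrain itself for `m = false`, and its mirror image for `m = true`. -/
noncomputable def side (m : Bool) : OrthogonalTerrain n := if m then T.mirror else T

theorem guards_cross {a a' b d : ℕ} (h1 : Guards T.X T.Y a b) (h2 : Guards T.X T.Y a' b)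
    (h3 : Guards T.X T.Y a' d) (ha : a ≤ a') (hb : b < d) (hd : 2 * d < n) :
    Guards T.X T.Y a d := by
  rcases ha.lt_or_eq with ha | rfl
  · have hab := h2.1
    refine ⟨h1.1.trans hb, h1.2.1, h1.2.2.cross (b := 2 * a') (by omega) (by omega) (by omega)
      (T.X_lt_even (by omega) (by omega) (even_two_mul _))
      (T.X_lt_even (by omega) (by omega) (even_two_mul _))
      (T.X_lt_even (by omega) hd (even_two_mul _)) (fun i j hij hj => T.X_mono hij (by omega))
      (fun k hk => T.X_lt_even hk hd (even_two_mul _)) h3.2.2⟩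
  · exact h3

theorem reflex_and_sees_of_guards {a b : ℕ} {u v : Fin n} (hu : (u : ℕ) = 2 * a)
    (hv : (v : ℕ) = 2 * b) (h : Guards T.X T.Y a b) : T.IsReflex u ∧ T.Sees u v := by
  have hab := h.1
  refine ⟨?_, T.sees_of_overlooks (hv ▸ even_two_mul b) (by omega) ?_⟩
  · rw [T.isReflex_even (hu ▸ even_two_mul a), hu]
    exact h.2.1
  · rw [hu, hv]
    exact h.2.2

theorem guards_of_sees {u v : Fin n} (hu : Even (u : ℕ)) (hr : T.IsReflex u) (hv : T.IsConvex v)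
    (h : T.Sees u v) : ∃ a b, (u : ℕ) = 2 * a ∧ (v : ℕ) = 2 * b ∧ Guards T.X T.Y a b := by
  obtain ⟨h1, h2, h3⟩ := h.even_overlooks hu hr hv
  obtain ⟨a, ha⟩ := hu
  obtain ⟨b, hb⟩ := h1
  rw [← two_mul] at ha hb
  have hr' := (T.isReflex_even (ha ▸ even_two_mul a)).1 hr
  rw [ha] at hr' h3
  rw [hb] at h3
  exact ⟨a, b, ha, hb, by omega, hr', h3⟩

theorem mirrorIdx_true {u : Fin n} {i : ℕ} (h : (u : ℕ) = mirrorIdx true n i) (hi : i < n) :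
    (u.rev : ℕ) = i := by
  simp only [mirrorIdx, if_true] at h
  rw [Fin.val_rev]
  omega

theorem side_sees {m : Bool} {a b : ℕ} {u v : Fin n} (hu : (u : ℕ) = mirrorIdx m n (2 * a))
    (hv : (v : ℕ) = mirrorIdx m n (2 * b)) (hb : 2 * b < n)
    (h : Guards (T.side m).X (T.side m).Y a b) : T.IsReflex u ∧ T.Sees u v := by
  cases m
  · exact T.reflex_and_sees_of_guards hu hv h
  · have hab := h.1
    have h1 := T.mirror.reflex_and_sees_of_guards (mirrorIdx_true hu (by omega))
      (mirrorIdx_true hv hb) h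
    rw [isReflex_mirror, sees_mirror, Fin.rev_rev, Fin.rev_rev] at h1
    exact h1

theorem side_isConvex {m : Bool} {b : ℕ} {v : Fin n} (hv : (v : ℕ) = mirrorIdx m n (2 * b))
    (hb : 2 * b < n) : T.IsConvex v ↔ (T.side m).Y (2 * b) < (T.side m).Y (2 * b + 1) := by
  cases m
  · have hv : (v : ℕ) = 2 * b := hv
    rw [T.isConvex_even (hv ▸ even_two_mul b), hv]
    rfl
  · have hv' := mirrorIdx_true hv hb
    have h1 := T.isConvex_mirror (u := v.rev)
    rw [Fin.rev_rev] at h1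
    rw [← h1, T.mirror.isConvex_even (hv' ▸ even_two_mul b), hv']
    rfl

/-- Each vertex has even index either in the terrain or in its mirror image, as `n` is even. -/
theorem exists_mirrorIdx (T : OrthogonalTerrain n) (i : Fin n) :
    ∃ m a, (i : ℕ) = mirrorIdx m n (2 * a) ∧ 2 * a < n := by
  have hn := T.even
  rcases Nat.even_or_odd (i : ℕ) with ⟨a, ha⟩ | ⟨a, ha⟩
  · exact ⟨false, a, by simp only [mirrorIdx, Bool.false_eq_true, if_false]; omega, by omega⟩
  · obtain ⟨h, hh⟩ := hn
    exact ⟨true, h - 1 - a, by simp only [mirrorIdx, if_true]; omega, by omega⟩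

theorem mirrorIdx_unique (T : OrthogonalTerrain n) {m m' : Bool} {a a' : ℕ}
    (h : mirrorIdx m n (2 * a) = mirrorIdx m' n (2 * a')) (ha : 2 * a < n) (ha' : 2 * a' < n) :
    m = m' ∧ a = a' := by
  obtain ⟨k, hk⟩ := T.even
  cases m <;> cases m' <;> simp only [mirrorIdx, Bool.false_eq_true, if_false, if_true] at h <;>
    simp <;> omega

/-- All the reflex vertices that see a given convex vertex belong to its side of the problem. -/
theorem side_guards {m : Bool} {b : ℕ} {u v : Fin n} (hr : T.IsReflex u) (hc : T.IsConvex v)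
    (h : T.Sees u v) (hv : (v : ℕ) = mirrorIdx m n (2 * b)) (hb : 2 * b < n) :
    ∃ a, (u : ℕ) = mirrorIdx m n (2 * a) ∧ Guards (T.side m).X (T.side m).Y a b := by
  obtain ⟨m', a, hu, ha⟩ := T.exists_mirrorIdx u
  have key : ∃ a' b', (u : ℕ) = mirrorIdx m' n (2 * a') ∧ (v : ℕ) = mirrorIdx m' n (2 * b') ∧
      2 * b' < n ∧ Guards (T.side m').X (T.side m').Y a' b' := by
    cases m'
    · obtain ⟨a', b', h1, h2, h3⟩ := T.guards_of_sees (hu ▸ even_two_mul a) hr hc h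
      exact ⟨a', b', h1, h2, h2 ▸ v.2, h3⟩
    · have h' : T.mirror.Sees u.rev v.rev := T.sees_mirror.2 (by simpa using h)
      obtain ⟨a', b', h1, h2, h3⟩ := T.mirror.guards_of_sees (u := u.rev) (v := v.rev)
        (mirrorIdx_true hu ha ▸ even_two_mul a) (T.isReflex_mirror.2 (by simpa using hr))
        (T.isConvex_mirror.2 (by simpa using hc)) h'
      refine ⟨a', b', ?_, ?_, h2 ▸ v.rev.2, h3⟩
      · simp only [mirrorIdx, if_true]
        rw [Fin.val_rev] at h1
        omega
      · simp only [mirrorIdx, if_true]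
        rw [Fin.val_rev] at h2
        omega
  obtain ⟨a', b', h1, h2, h3, h4⟩ := key
  obtain ⟨rfl, rfl⟩ := T.mirrorIdx_unique (hv.symm.trans h2) hb h3
  exact ⟨a', h1, h4⟩

/-- The guards chosen on both sides form a minimum guard set: no guard sees two of the witnesses of
both sides, and there are at least as many witnesses as chosen guards. -/
theorem isMinGuardSet_of_greedy {S W : Bool → Finset ℕ} {O : Finset (Fin n)}
    (h : ∀ m, Greedy (Guards (T.side m).X (T.side m).Y)
      (fun b => (T.side m).Y (2 * b) < (T.side m).Y (2 * b + 1)) (n / 2) (n / 2) (S m) (W m))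
    (hO : ∀ i, i ∈ O ↔ ∃ m, ∃ a ∈ S m, (i : ℕ) = mirrorIdx m n (2 * a))
    (hcov : ∀ m, ∀ b < n / 2, (T.side m).Y (2 * b) < (T.side m).Y (2 * b + 1) →
      ∃ a ∈ S m, Guards (T.side m).X (T.side m).Y a b) : T.IsMinGuardSet O := by
  have hn := Nat.two_mul_div_two_of_even T.even
  refine ⟨⟨fun g hg => ?_, fun c hc => ?_⟩, fun S' hS' => ?_⟩
  · obtain ⟨m, a, ha, hg⟩ := (hO g).1 hg
    obtain ⟨b, hb, hab⟩ := (h m).useful a ha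
    exact (T.side_sees (v := ⟨mirrorIdx m n (2 * b), mirrorIdx_lt (by omega)⟩) hg rfl (by omega)
      hab).1
  · obtain ⟨m, b, hcb, hb⟩ := T.exists_mirrorIdx c
    obtain ⟨a, ha, hab⟩ := hcov m b (by omega) ((T.side_isConvex hcb hb).1 hc)
    have hlt := hab.1
    exact ⟨⟨mirrorIdx m n (2 * a), mirrorIdx_lt (by omega)⟩, (hO _).2 ⟨m, a, ha, rfl⟩,
      (T.side_sees rfl hcb hb hab).2⟩
  · have h1 : O.card ≤ (Finset.univ.sigma S).card := by
      have hsub : O.map Fin.valEmbedding ⊆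
          (Finset.univ.sigma S).image fun p => mirrorIdx p.1 n (2 * p.2) := by
        intro i hi
        obtain ⟨g, hg, rfl⟩ := Finset.mem_map.1 hi
        obtain ⟨m, a, ha, hg⟩ := (hO g).1 hg
        exact Finset.mem_image.2 ⟨⟨m, a⟩, by simpa using ha, hg.symm⟩
      rw [← Finset.card_map Fin.valEmbedding]
      exact (Finset.card_le_card hsub).trans Finset.card_image_le
    have h2 : (Finset.univ.sigma S).card ≤ (Finset.univ.sigma W).card := by
      rw [Finset.card_sigma, Finset.card_sigma]
      exact Finset.sum_le_sum fun m _ => (h m).card_le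
    have h3 : ∀ p ∈ (Finset.univ.sigma W), ∃ g ∈ S', ∃ a, 2 * a < n ∧
        (g : ℕ) = mirrorIdx p.1 n (2 * a) ∧
        Guards (T.side p.1).X (T.side p.1).Y a p.2 := by
      rintro ⟨m, b⟩ hp
      have hbW : b ∈ W m := by simpa using hp
      obtain ⟨hb, hconv⟩ := (h m).target b hbW
      have hc := (T.side_isConvex (v := ⟨mirrorIdx m n (2 * b), mirrorIdx_lt (by omega)⟩) rfl
        (by omega)).2 hconv
      obtain ⟨g, hg, hs⟩ := hS'.2 _ hc
      obtain ⟨a, h4, h5⟩ := T.side_guards (hS'.1 g hg) hc hs rfl (by omega)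
      have := h5.1
      exact ⟨g, hg, a, by omega, h4, h5⟩
    have : Nonempty (Fin n) := ⟨T.first⟩
    choose! f hf hf' using h3
    refine (h1.trans h2).trans (Finset.card_le_card_of_injOn f hf ?_)
    rintro ⟨m, b⟩ hp ⟨m', b'⟩ hp' he
    obtain ⟨a, ha, h4, h5⟩ := hf' _ hp
    obtain ⟨a', ha', h6, h7⟩ := hf' _ hp'
    rw [he] at h4
    obtain ⟨h8, rfl⟩ := T.mirrorIdx_unique (h4.symm.trans h6) ha ha'
    simp only at h8
    subst h8
    rw [(h m).indep b (by simpa using hp) b' (by simpa using hp') a h5 h7]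

end OrthogonalTerrain

/-! ### Correctness and running time of the program -/

/-- The cost bound of `guardProg`. -/
def totalCost {R : Type*} [CommSemiring R] (n B : R) : R :=
  unitCost n B + (sideCost n (unitCost n B) + sideCost n (unitCost n B))

/-- The variables at the beginning. -/
def initialSt : St := ⟨0, fun _ => 0, 0, 0, 0, 0, 0, 0, 0⟩

section Total

variable {K : Type} [Field K] {n : ℕ}

theorem inputMemory_eq (x y : Fin n → K) :
    inputMemory x y = initialSt.mem n (inputMemory x y).fld := by
  unfold St.mem inputMemory
  congr 1
  funext A a
  split
  · simp_all
  · split <;> simp_all [initialSt]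

variable {φ : K →+* ℝ} {T : OrthogonalTerrain n} {x y : Fin n → K}

theorem side_X_eq (hx : ∀ i, T.x i = φ (x i)) (m : Bool) {k : ℕ} (hk : k < n) :
    (T.side m).X k = φ (virtX m n (inputMemory x y).fld k) := by
  rw [OrthogonalTerrain.X_eq _ hk]
  cases m
  · simp [OrthogonalTerrain.side, virtX, inputMemory, hk, hx]
  · have h1 : n - 1 - k < n := by omega
    have h2 : Fin.rev ⟨k, hk⟩ = ⟨n - 1 - k, h1⟩ := Fin.ext (by rw [Fin.val_rev]; simp; omega)
    simp [OrthogonalTerrain.side, virtX, inputMemory, h1, hx, OrthogonalTerrain.mirror, h2]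

theorem side_Y_eq (hy : ∀ i, T.y i = φ (y i)) (m : Bool) {k : ℕ} (hk : k < n) :
    (T.side m).Y k = φ (virtY m n (inputMemory x y).fld k) := by
  rw [OrthogonalTerrain.Y_eq _ hk]
  cases m
  · simp [OrthogonalTerrain.side, virtY, inputMemory, hk, hy, mirrorIdx]
  · have h1 : n - 1 - k < n := by omega
    have h2 : Fin.rev ⟨k, hk⟩ = ⟨n - 1 - k, h1⟩ := Fin.ext (by rw [Fin.val_rev]; simp; omega)
    simp [OrthogonalTerrain.side, virtY, inputMemory, h1, hy, OrthogonalTerrain.mirror, h2,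
      mirrorIdx]

theorem Greedy.congr {V V' : ℕ → ℕ → Prop} {C C' : ℕ → Prop} {N : ℕ} {S W : Finset ℕ}
    (h : Greedy V C N N S W) (hV : ∀ b < N, ∀ a, V' a b ↔ V a b) (hC : ∀ b < N, C' b ↔ C b) :
    Greedy V' C' N N S W where
  card_le := h.card_le
  useful a ha := by
    obtain ⟨b, hb, hab⟩ := h.useful a ha
    exact ⟨b, hb, (hV b hb a).2 hab⟩
  target b hb := ⟨(h.target b hb).1, (hC b (h.target b hb).1).2 (h.target b hb).2⟩
  indep b hb b' hb' a h1 h2 := h.indep b hb b' hb' a ((hV b (h.target b hb).1 a).1 h1)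
    ((hV b' (h.target b' hb').1 a).1 h2)
  dom b hb a d h1 h2 h3 h4 := by
    obtain ⟨a', h5, h6⟩ := h.dom b hb a d ((hV b (h.target b hb).1 a).1 h1) h2 h3
      ((hV d h3 a).1 h4)
    exact ⟨a', h5, (hV d h3 a').2 h6⟩

variable [LinearOrder K]

/-- The program is correct on coordinates in any ordered field `K` embedded in the reals, and its
cost is bounded in terms of `n` and a bound `B` on the sizes of the field numbers. -/
theorem exec_guardProg (hφ : StrictMono φ) (hx : ∀ i, T.x i = φ (x i))
    (hy : ∀ i, T.y i = φ (y i)) {w : K → ℕ} {B : ℕ} (hB : Sized w n (inputMemory x y).fld B) :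
    ∃ τ c, Exec w guardProg (inputMemory x y) τ c ∧ c ≤ totalCost n B ∧ CorrectOutput T τ := by
  have hn := Nat.two_mul_div_two_of_even T.even
  generalize hfld : (inputMemory x y).fld = fld at hB
  have hV : ∀ m, ∀ b < n / 2, ∀ a, Guards (T.side m).X (T.side m).Y a b ↔
      VirtGuards m n fld a b := fun m b hb a =>
    hfld ▸ Guards.map hφ (n := n) (by omega) (fun k hk => side_X_eq hx m hk)
      (fun k hk => side_Y_eq hy m hk)
  have hC : ∀ m, ∀ b < n / 2, (T.side m).Y (2 * b) < (T.side m).Y (2 * b + 1) ↔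
      VirtConvex m n fld b := fun m b hb => by
    rw [side_Y_eq (x := x) hy m (by omega), side_Y_eq (x := x) hy m (by omega), hφ.lt_iff_lt, hfld]
    rfl
  have cross : ∀ m a a' b d, VirtGuards m n fld a b → VirtGuards m n fld a' b →
      VirtGuards m n fld a' d → a ≤ a' → b < d → d < n / 2 → VirtGuards m n fld a d := by
    intro m a a' b d h1 h2 h3 h4 h5 h6
    rw [← hV m b (h5.trans h6)] at h1 h2
    rw [← hV m d h6] at h3 ⊢
    exact (T.side m).guards_cross h1 h2 h3 h4 h5 (by omega)
  -- a convex vertex without guards rules out all guard sets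
  have hnone : ∀ m, (∃ b < n / 2, VirtConvex m n fld b ∧ ∀ a, ¬ VirtGuards m n fld a b) →
      ∀ S : Finset (Fin n), ¬ T.IsGuardSet S := by
    rintro m ⟨b, hb, hconv, hno⟩ S hS
    have hc := (T.side_isConvex (m := m) (v := ⟨mirrorIdx m n (2 * b), mirrorIdx_lt (by omega)⟩) rfl
      (by omega)).2 ((hC m b hb).2 hconv)
    obtain ⟨g, hg, hs⟩ := hS.2 _ hc
    obtain ⟨a, -, h⟩ := T.side_guards (hS.1 g hg) hc hs rfl (by omega)
    exact hno a ((hV m b hb a).1 h)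
  have run : Runs w n fld guardProg initialSt (totalCost n B)
      fun s => CorrectOutput T (s.mem n fld) := by
    refine Runs.seq (Q := fun s => s = { initialSt with ans := 1 })
      (Runs.assign rfl (upd_ans _ 1) ((cost_const_le 1 _).trans (by omega)) rfl) ?_
    rintro _ rfl
    refine Runs.seq (runs_sideProg hB false T.even (fun _ => zero_le_one) (fun _ _ => rfl)
      (cross false)) ?_
    rintro s1 ⟨S1, W1, h1⟩
    have hout1 : ∀ p, s1.out p = if ∃ a ∈ S1, p = mirrorIdx false n (2 * a) then 1 else 0 := h1.out
    have hS1 : ∀ a ∈ S1, 2 * a < n := fun a ha => by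
      obtain ⟨b, hb, hab⟩ := h1.greedy.useful a ha
      have := hab.1
      omega
    refine (runs_sideProg hB true T.even ?_ ?_ (cross true)).mono le_rfl ?_
    · intro p
      rw [hout1]
      split <;> omega
    · intro a ha
      rw [hout1, if_neg]
      rintro ⟨a', ha', he⟩
      exact absurd (T.mirrorIdx_unique he ha (hS1 a' ha')).1 (by simp)
    rintro s ⟨S2, W2, h2⟩
    rcases h1.ans with ⟨h3, h4⟩ | ⟨h3, h4⟩
    · rcases h2.ans with ⟨h5, h6⟩ | ⟨h5, h6⟩
      · refine Or.inl ⟨h5.trans h3, T.isMinGuardSet_of_greedy (S := fun m => if m then S2 else S1)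
          (W := fun m => if m then W2 else W1) ?_ ?_ ?_⟩
        · rintro (_ | _)
          · exact h1.greedy.congr (hV false) (hC false)
          · exact h2.greedy.congr (hV true) (hC true)
        · intro i
          have : i ∈ outputSet n (s.mem n fld) ↔ s.out i = 1 := by
            simp only [outputSet, Finset.mem_filter, Finset.mem_univ, true_and]
            rfl
          rw [this, h2.out, hout1, Bool.exists_bool]
          simp only [Bool.false_eq_true, if_false, if_true]
          split
          · simp [*]
          · split <;> simp [*]
        · rintro (_ | _) b hb hc
          · obtain ⟨a, ha, hab⟩ := h4 b hb ((hC false b hb).1 hc)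
            exact ⟨a, ha, (hV false b hb a).2 hab⟩
          · obtain ⟨a, ha, hab⟩ := h6 b hb ((hC true b hb).1 hc)
            exact ⟨a, ha, (hV true b hb a).2 hab⟩
      · exact Or.inr ⟨h5, hnone true h6⟩
    · refine Or.inr ⟨?_, hnone false h4⟩
      rcases h2.ans with ⟨h5, -⟩ | ⟨h5, -⟩
      · exact h5.trans h3
      · exact h5
  obtain ⟨s', c, hE, hc, hQ⟩ := run
  exact ⟨_, c, by rw [inputMemory_eq, hfld]; exact hE, hc, hQ⟩

end Total

theorem totalCost_mono {n n' B B' : ℕ} (hn : n ≤ n') (hB : B ≤ B') :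
    totalCost n B ≤ totalCost n' B' := by
  unfold totalCost sideCost scanCost overlookCost loopCost unitCost
  gcongr

theorem eval_totalCost (p q : Polynomial ℕ) (a : ℕ) :
    (totalCost p q).eval a = totalCost (p.eval a) (q.eval a) := by
  simp [totalCost, sideCost, scanCost, overlookCost, loopCost, unitCost]

theorem guardProg_solvesVTGRealRAM : SolvesVTGRealRAM guardProg := by
  refine ⟨totalCost .X 0, fun n T => ?_⟩
  have hB : Sized (fun _ : ℝ => 0) n (inputMemory T.x T.y).fld 0 :=
    ⟨fun _ _ _ _ => le_rfl, fun _ _ _ _ _ _ => le_rfl, fun _ _ _ _ _ _ _ _ => le_rfl⟩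
  have := exec_guardProg (φ := RingHom.id ℝ) strictMono_id (fun _ => rfl) (fun _ => rfl) hB
  simpa [eval_totalCost] using this

/-! ### Bit lengths of rational numbers -/

/-- The numerator and the denominator have at most `k` bits. -/
def BitBound (k : ℕ) (q : ℚ) : Prop := q.num.natAbs < 2 ^ k ∧ q.den < 2 ^ k

theorem bitBound_ratBits (q : ℚ) : BitBound (ratBits q) q :=
  ⟨Nat.size_le.1 (Nat.le_add_right _ _), Nat.size_le.1 (Nat.le_add_left _ _)⟩

theorem BitBound.ratBits_le {k : ℕ} {q : ℚ} (h : BitBound k q) : ratBits q ≤ 2 * k := by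
  have h1 := Nat.size_le.2 h.1
  have h2 := Nat.size_le.2 h.2
  unfold ratBits
  omega

theorem BitBound.mono {k l : ℕ} {q : ℚ} (h : BitBound k q) (hkl : k ≤ l) : BitBound l q :=
  ⟨h.1.trans_le (Nat.pow_le_pow_right two_pos hkl), h.2.trans_le (Nat.pow_le_pow_right two_pos hkl)⟩

/-- Reducing a fraction to lowest terms does not increase its size. -/
theorem bitBound_of_eq_div {k : ℕ} {q : ℚ} {a : ℤ} {b : ℕ} (hq : q = (a : ℚ) / (b : ℚ))
    (hb0 : b ≠ 0) (ha : a.natAbs < 2 ^ k) (hb : b < 2 ^ k) : BitBound k q := by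
  have hq' : q = Rat.divInt a b := by rw [hq, Rat.divInt_eq_div]; simp
  have hbz : (b : ℤ) ≠ 0 := by exact_mod_cast hb0
  constructor
  · rcases eq_or_ne a 0 with rfl | ha0
    · simp [hq]
    · have := Rat.num_dvd a hbz
      rw [← hq'] at this
      exact (Nat.le_of_dvd (Int.natAbs_pos.2 ha0) (Int.natAbs_dvd_natAbs.2 this)).trans_lt ha
  · have := Rat.den_dvd a b
    rw [← hq'] at this
    exact (Nat.le_of_dvd (Nat.pos_of_ne_zero hb0) (Int.natCast_dvd_natCast.1 this)).trans_lt hb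

theorem BitBound.sub {k : ℕ} {p q : ℚ} (hp : BitBound k p) (hq : BitBound k q) :
    BitBound (2 * k + 1) (p - q) := by
  have e : (2 : ℕ) ^ (2 * k + 1) = 2 ^ k * 2 ^ k + 2 ^ k * 2 ^ k := by ring
  have hp0 := p.den_nz
  have hq0 := q.den_nz
  refine bitBound_of_eq_div (a := p.num * q.den - q.num * p.den) (b := p.den * q.den) ?_
    (mul_ne_zero hp0 hq0) ?_ ?_
  · conv_lhs => rw [← p.num_div_den, ← q.num_div_den]
    have hp' : (p.den : ℚ) ≠ 0 := by exact_mod_cast hp0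
    have hq' : (q.den : ℚ) ≠ 0 := by exact_mod_cast hq0
    push_cast
    field_simp
  · refine (Int.natAbs_sub_le _ _).trans_lt ?_
    rw [Int.natAbs_mul, Int.natAbs_mul, Int.natAbs_natCast, Int.natAbs_natCast, e]
    exact Nat.add_lt_add (Nat.mul_lt_mul'' hp.1 hq.2) (Nat.mul_lt_mul'' hq.1 hp.2)
  · rw [e]
    exact (Nat.mul_lt_mul'' hp.2 hq.2).trans_le (Nat.le_add_right _ _)

theorem BitBound.mul {k : ℕ} {p q : ℚ} (hp : BitBound k p) (hq : BitBound k q) :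
    BitBound (2 * k) (p * q) := by
  have e : (2 : ℕ) ^ (2 * k) = 2 ^ k * 2 ^ k := by ring
  refine bitBound_of_eq_div (a := p.num * q.num) (b := p.den * q.den) ?_
    (mul_ne_zero p.den_nz q.den_nz) ?_ ?_
  · conv_lhs => rw [← p.num_div_den, ← q.num_div_den]
    push_cast
    rw [div_mul_div_comm]
  · rw [Int.natAbs_mul, e]
    exact Nat.mul_lt_mul'' hp.1 hq.1
  · rw [e]
    exact Nat.mul_lt_mul'' hp.2 hq.2

theorem guardProg_solvesVTGBitCost : SolvesVTGBitCost guardProg := by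
  refine ⟨totalCost .X (8 * .X + 4), fun n T x y hx hy => ?_⟩
  set s := ∑ i, (ratBits (x i) + ratBits (y i)) with hs
  have hle : ∀ i, ratBits (x i) + ratBits (y i) ≤ s := fun i =>
    Finset.single_le_sum (f := fun i => ratBits (x i) + ratBits (y i)) (fun _ _ => Nat.zero_le _)
      (Finset.mem_univ i)
  have hn : n ≤ s := by
    have h1 : ∀ i ∈ (Finset.univ : Finset (Fin n)), 1 ≤ ratBits (x i) + ratBits (y i) := by
      intro i _
      have := Nat.size_pos.2 (x i).den_pos
      unfold ratBits
      omega
    simpa using Finset.card_nsmul_le_sum _ _ 1 h1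
  -- differences of coordinates have `2 s + 1` bits in numerator and denominator, products of two
  -- differences twice as many
  have hbit : ∀ A i, A < 2 → i < n → BitBound s ((inputMemory x y).fld A i) := by
    intro A i hA hi
    have h1 := hle ⟨i, hi⟩
    have hA' : A = 0 ∨ A = 1 := by omega
    rcases hA' with rfl | rfl
    · simpa [inputMemory, hi] using (bitBound_ratBits (x ⟨i, hi⟩)).mono (by omega)
    · simpa [inputMemory, hi] using (bitBound_ratBits (y ⟨i, hi⟩)).mono (by omega)
  have hB : Sized ratBits n (inputMemory x y).fld (8 * s + 4) := by
    refine ⟨fun A i hA hi => ?_, fun A i j hA hi hj => ?_, fun i j k l hi hj hk hl => ?_⟩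
    · have := (hbit A i hA hi).ratBits_le
      omega
    · have := ((hbit A i hA hi).sub (hbit A j hA hj)).ratBits_le
      omega
    · have := (((hbit 1 i one_lt_two hi).sub (hbit 1 j one_lt_two hj)).mul
        ((hbit 0 k two_pos hk).sub (hbit 0 l two_pos hl))).ratBits_le
      omega
  obtain ⟨τ, c, h1, h2, h3⟩ := exec_guardProg (φ := Rat.castHom ℝ) (T := T) Rat.cast_strictMono
    hx hy hB
  refine ⟨τ, c, h1, h2.trans ?_, h3⟩
  rw [eval_totalCost]
  simpa using totalCost_mono hn le_rfl

end VTG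

theorem mainTheorem1 : ∃ P : VTG.Prog, VTG.SolvesVTGRealRAM P ∧ VTG.SolvesVTGBitCost P :=
  ⟨VTG.guardProg, VTG.guardProg_solvesVTGRealRAM, VTG.guardProg_solvesVTGBitCost⟩
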